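/- **Conventions.** Let $n\ge 0$ and regard $\mathbb Z^n\subset\mathbb R^n$. For a submonoid $M\subset\mathbb Z^n$ let $\operatorname{gp}(M)$ be the subgroup it generates, $\mathbb R_+M\subset\mathbb R^n$ the convex cone it generates, and $M_*=(\operatorname{int}(\mathbb R_+M)\cap M)\cup\{0\}$. The monoid $M$ is affine if it is finitely generated, positive if it has no nontrivial units, and normal if $x\in\operatorname{gp}(M)$, $c\in\{1,2,\dots\}$ and $cx\in M$ imply $x\in M$. Throughout, $\operatorname{int}$ denotes the relative interior. A *rational cone* is a convex cone $D\subset\mathbb R^n$ with $D\neq\{0\}$ that is generated by finitely many elements of $\mathbb Z^n$ and contains no line. A polytope $P'$ is a pyramid with apex $x$ and base $F$ if $F$ is a facet of $P'$, $x$ is a vertex of $P'$ outside the affine hull of $F$, and $P'=\operatorname{conv}(\{x\}\cup F)$. An extension of polytopes $P\subset Q$, $P\ne Q$, is *pyramidal* if there are a vertex $x$ of $Q$ and a polytope $P'$ such that $Q=P\cup P'$, $\dim P=\dim P'=\dim Q$, and $P'$ is a pyramid with apex $x$ and base $P\cap P'$. **Data.** Let $\mathbf k$ be a number field, and let $M\subset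 N\subset\mathbb Z^n$ be nonzero affine positive normal monoids with $\operatorname{gp}(M)=\operatorname{gp}(N)=\mathbb Z^n$. Fix a rational affine hyperplane $H=\{x: h(x)=1\}$, where $h$ is a linear form with rational coefficients that is positive on $\mathbb R_+N\setminus\{0\}$, and put $\Phi(M)=H\cap\mathbb R_+M$ and $\Phi(N)=H\cap\mathbb R_+N$. Assume that $M\subset N$ is a pyramidal extension, i.e. that $\Phi(M)\subset\Phi(N)$ is a pyramidal extension of polytopes. Fix a grading of $\mathbf k[N]$ in which the elements of $N$ are homogeneous and the nontrivial elements of $N$ have positive degree. Let $D,D'$ be rational cones with $D\subset\operatorname{int}(D')\cup\{0\}$ and $D'\subset\mathbb R_+M_*$. Let $v\in\Phi(N)\setminus\Phi(M)$ be a rational point and let $t\in(\mathbb R_+v)\cap\mathbb Z^n$ be nonzero. Writing monomials multiplicatively and putting $L=D\cap\mathbb Z^n$, let $$\Lambda=\Lambda(D,t)=\begin{pmatrix}\mathbf k[L]&\mathbf k[L]\cap t^{-1}\mathbf k[L]\\ \mathbf k[L]+t\,\mathbf k[L]&\mathbf k[L]\end{pmatrix}\subset M_{2\times2}(\mathbf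 k[N]),$$ and let $\Lambda'=\Lambda(D',t)\supset\Lambda$ be the ring that is defined in the same way from $L'=D'\cap\mathbb Z^n$. Both rings carry the grading induced from $\mathbf k[N]$. For $s\ge0$ let $\Lambda_{[s]}=\Lambda_0\oplus\Lambda_s\oplus\Lambda_{s+1}\oplus\cdots$ (so $\Lambda_{[0]}=\Lambda_{[1]}=\Lambda$), and similarly $\Lambda'_{[s]}$. For a $\mathbb Q$-algebra $A$ let $C_*(A)$ be its Hochschild complex over $\mathbb Q$, with $C_i(A)=A^{\otimes(i+1)}$ and the usual Hochschild differential, and let $$HH_i(\Lambda,s)=H_i\bigl(C_*(\Lambda)/C_*(\Lambda_{[s]})\bigr),\qquad HH_i(\Lambda',s)=H_i\bigl(C_*(\Lambda')/C_*(\Lambda'_{[s]})\bigr).$$ **Theorem 6.1.** For all integers $i\ge0$ and $s\ge0$, the image of the map $HH_i(\Lambda,s)\to HH_i(\Lambda',s)$ induced by the inclusion $\Lambda\subset\Lambda'$ is finite dimensional: $$\dim_{\mathbb Q}\operatorname{Im}\bigl(HH_i(\Lambda,s)\to HH_i(\Lambda',s)\bigr)<\infty .$$ -/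

import Mathlib

open scoped TensorProduct

noncomputable section

namespace PoleRing

/-! ### Polytopes -/

section Polytopes

variable {n : ℕ}

/-- A polytope: the convex hull of a finite set. -/
def IsPolytope (P : Set (Fin n → ℝ)) : Prop :=
  ∃ S : Finset (Fin n → ℝ), P = convexHull ℝ (S : Set (Fin n → ℝ))

/-- The dimension of the affine hull (used only for nonempty sets). -/
def affDim (P : Set (Fin n → ℝ)) : ℕ :=
  Module.finrank ℝ (affineSpan ℝ P).direction

/-- `F` is a facet of `P`: the (nonempty) intersection of `P` with a supporting hyperplane, of
dimension one less than the dimension of `P`. -/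
def IsFacet (P F : Set (Fin n → ℝ)) : Prop :=
  F.Nonempty ∧ IsExposed ℝ P F ∧ affDim F + 1 = affDim P

/-- `x` is a vertex of `P`: `{x}` is a face of `P`. -/
def IsVertex (P : Set (Fin n → ℝ)) (x : Fin n → ℝ) : Prop :=
  IsExposed ℝ P {x}

/-- `P` is a pyramid with apex `x` and base `F`. -/
def IsPyramid (P : Set (Fin n → ℝ)) (x : Fin n → ℝ) (F : Set (Fin n → ℝ)) : Prop :=
  IsPolytope P ∧ IsFacet P F ∧ IsVertex P x ∧ x ∉ affineSpan ℝ F ∧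
    P = convexHull ℝ (insert x F)

/-- `P ⊂ Q` is a pyramidal extension of polytopes: `P` is obtained from `Q` by cutting off a
pyramid `P'` at a vertex of `Q`. -/
def IsPyramidalPolytopeExtension (P Q : Set (Fin n → ℝ)) : Prop :=
  IsPolytope P ∧ IsPolytope Q ∧ P ⊆ Q ∧ P ≠ Q ∧
    ∃ (P' : Set (Fin n → ℝ)) (x : Fin n → ℝ),
      IsVertex Q x ∧ Q = P ∪ P' ∧ affDim P = affDim Q ∧ affDim P' = affDim Q ∧
        IsPyramid P' x (P ∩ P')

end Polytopes

/-! ### Monoids and cones -/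

section Cones

variable {n : ℕ}

/-- The inclusion `ℤⁿ → ℝⁿ`. -/
def toReal (n : ℕ) : (Fin n → ℤ) →+ (Fin n → ℝ) where
  toFun m := fun j => (m j : ℝ)
  map_zero' := by ext; simp
  map_add' _ _ := by ext; simp

/-- The group of differences `gp(M)` of a submonoid `M ⊆ ℤⁿ`. -/
def gp (M : AddSubmonoid (Fin n → ℤ)) : AddSubgroup (Fin n → ℤ) :=
  AddSubgroup.closure (M : Set (Fin n → ℤ))

/-- Nonzero affine (finitely generated) positive (without nontrivial units) normal monoids. -/
structure IsNonzeroAffinePositiveNormal (M : AddSubmonoid (Fin n → ℤ)) : Prop where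
  ne_bot : M ≠ ⊥
  fg : M.FG
  positive : ∀ x ∈ M, -x ∈ M → x = 0
  normal : ∀ x ∈ gp M, ∀ c : ℕ, 0 < c → c • x ∈ M → x ∈ M

/-- The cone `ℝ₊W` generated by a set `W` of lattice points. -/
def realCone (W : Set (Fin n → ℤ)) : PointedCone ℝ (Fin n → ℝ) :=
  PointedCone.hull ℝ (toReal n '' W)

/-- The set `M_*` of those elements of `M` that lie in the relative interior of `ℝ₊M`, together
with `0`. -/
def interiorMonoid (M : AddSubmonoid (Fin n → ℤ)) : Set (Fin n → ℤ) :=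
  {m | m ∈ M ∧ toReal n m ∈ intrinsicInterior ℝ (realCone (M : Set (Fin n → ℤ)) : Set (Fin n → ℝ))}
    ∪ {0}

/-- A rational cone: generated by finitely many lattice points, containing no line, of positive
dimension. -/
structure IsRationalCone (D : PointedCone ℝ (Fin n → ℝ)) : Prop where
  rational : ∃ S : Finset (Fin n → ℤ), D = realCone (S : Set (Fin n → ℤ))
  pointed : ∀ x ∈ D, -x ∈ D → x = 0
  ne_bot : D ≠ ⊥

/-- The section `C ∩ H` of a cone with the rational hyperplane `H = {x | h₁x₁ + ⋯ + hₙxₙ = 1}`. -/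
def crossSection (h : Fin n → ℚ) (C : PointedCone ℝ (Fin n → ℝ)) : Set (Fin n → ℝ) :=
  {x | x ∈ C ∧ ∑ j, (h j : ℝ) * x j = 1}

/-- The form `h` is positive on `C \ {0}`; so `Φ(C) = crossSection h C` satisfies `ℝ₊Φ(C) = C`. -/
def IsCrossSectionForm (h : Fin n → ℚ) (C : PointedCone ℝ (Fin n → ℝ)) : Prop :=
  ∀ x ∈ C, x ≠ 0 → 0 < ∑ j, (h j : ℝ) * x j

/-- `Φ(M)` for a submonoid `M` of `ℤⁿ`. -/
def Phi (h : Fin n → ℚ) (M : AddSubmonoid (Fin n → ℤ)) : Set (Fin n → ℝ) :=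
  crossSection h (realCone (M : Set (Fin n → ℤ)))

/-- `M ⊂ N` is a pyramidal extension of monoids; the polytopes `Φ(M) ⊂ Φ(N)` are taken in the
hyperplane given by `h`. -/
structure IsPyramidalExtension (h : Fin n → ℚ) (M N : AddSubmonoid (Fin n → ℤ)) : Prop where
  le : M ≤ N
  left : IsNonzeroAffinePositiveNormal M
  right : IsNonzeroAffinePositiveNormal N
  gp_eq : gp M = gp N
  pyramidal : IsPyramidalPolytopeExtension (Phi h M) (Phi h N)

/-- A grading of `k[N]`, where `gp(N) = ℤⁿ`, in which the elements of `N` are homogeneous and the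
nontrivial ones have positive degree. It is given by the degrees of the elements of `N`, that is, by
an additive map `N → ℤ₊` with trivial kernel, and this extends uniquely to `gp(N) = ℤⁿ`. -/
def IsGradingOf (deg : (Fin n → ℤ) →+ ℤ) (N : AddSubmonoid (Fin n → ℤ)) : Prop :=
  ∀ m ∈ N, m ≠ 0 → 0 < deg m

/-- The monoid `L = D ∩ ℤⁿ`. -/
def latticePoints (D : PointedCone ℝ (Fin n → ℝ)) : AddSubmonoid (Fin n → ℤ) :=
  D.toAddSubmonoid.comap (toReal n)

theorem latticePoints_mono {D D' : PointedCone ℝ (Fin n → ℝ)} (h : D ≤ D') :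
    latticePoints D ≤ latticePoints D' :=
  fun _ hm => h hm

/-- `D ⊆ int(D') ∪ {0}`, with the relative interior of `D'`. -/
def IsInnerCone (D D' : PointedCone ℝ (Fin n → ℝ)) : Prop :=
  (D : Set (Fin n → ℝ)) ⊆ intrinsicInterior ℝ (D' : Set (Fin n → ℝ)) ∪ {0}

theorem IsInnerCone.le {D D' : PointedCone ℝ (Fin n → ℝ)} (h : IsInnerCone D D') : D ≤ D' := by
  intro x hx
  rcases h hx with hx' | hx'
  · exact intrinsicInterior_subset hx'
  · rw [Set.mem_singleton_iff.mp hx']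
    exact D'.zero_mem

end Cones

/-! ### The matrix rings `Λ(D, t)` -/

section Rings

variable (k : Type*) [Field k] {n : ℕ}

/-- The monoid ring `k[L]` inside the group ring `k[ℤⁿ]`. -/
def monoidRing (L : AddSubmonoid (Fin n → ℤ)) :
    Subalgebra k (AddMonoidAlgebra k (Fin n → ℤ)) where
  carrier := {f | ∀ m ∈ f.coeff.support, m ∈ L}
  mul_mem' {a b} ha hb m hm := by
    classical
    obtain ⟨x, hx, y, hy, rfl⟩ :=
      Finset.mem_add.1 (AddMonoidAlgebra.support_coeff_mul_subset a b hm)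
    exact L.add_mem (ha x hx) (hb y hy)
  add_mem' {a b} ha hb m hm := by
    classical
    exact (Finset.mem_union.mp (Finsupp.support_add hm)).elim (ha m) (hb m)
  algebraMap_mem' r m hm := by
    have h : m = 0 := by
      simpa using Finset.mem_singleton.1 (Finsupp.support_single_subset hm)
    rw [h]
    exact L.zero_mem

variable {k} in
theorem monoidRing_mono {L L' : AddSubmonoid (Fin n → ℤ)} (h : L ≤ L') :
    monoidRing k L ≤ monoidRing k L' :=
  fun _ hf m hm => h (hf m hm)

/-- The element `t` of `ℤⁿ`, as a monomial of `k[ℤⁿ]`. -/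
def monomial (t : Fin n → ℤ) : AddMonoidAlgebra k (Fin n → ℤ) :=
  AddMonoidAlgebra.single t 1

variable [CharZero k]

/-- The ring `Λ(D, t)`, as a `ℚ`-algebra: the 2×2 matrices with diagonal entries in `k[L]`, upper right entry
in `k[L] ∩ t⁻¹k[L]` and lower left entry in `k[L] + t k[L]`, where `L = D ∩ ℤⁿ`. The ambient ring
is that of the matrices over `k[ℤⁿ]`, which contains the matrices over `k[N]` if `N ⊆ ℤⁿ`. -/
def Lam (D : PointedCone ℝ (Fin n → ℝ)) (t : Fin n → ℤ) :
    Subalgebra ℚ (Matrix (Fin 2) (Fin 2) (AddMonoidAlgebra k (Fin n → ℤ))) where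
  carrier := {x |
    x 0 0 ∈ monoidRing k (latticePoints D) ∧
    (x 0 1 ∈ monoidRing k (latticePoints D) ∧
      ∃ g ∈ monoidRing k (latticePoints D), x 0 1 = monomial k (-t) * g) ∧
    (∃ f ∈ monoidRing k (latticePoints D), ∃ g ∈ monoidRing k (latticePoints D),
      x 1 0 = f + monomial k t * g) ∧
    x 1 1 ∈ monoidRing k (latticePoints D)}
  mul_mem' {x y} hx hy := by
    obtain ⟨x00, ⟨x01, u, hu, xu⟩, ⟨f, hf, g, hg, x10⟩, x11⟩ := hx
    obtain ⟨y00, ⟨y01, w, hw, yw⟩, ⟨f', hf', g', hg', y10⟩, y11⟩ := hy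
    have key : monomial k (-t) * monomial k t = 1 := by
      simp [monomial, AddMonoidAlgebra.single_mul_single, AddMonoidAlgebra.one_def]
    set S := monoidRing k (latticePoints D)
    simp only [Set.mem_ofPred_eq, Matrix.mul_apply, Fin.sum_univ_two]
    refine ⟨?_, ⟨?_, x 0 0 * w + u * y 1 1, ?_, ?_⟩,
      ⟨f * y 0 0 + x 1 1 * f', ?_, g * y 0 0 + x 1 1 * g', ?_, ?_⟩, ?_⟩
    · have : x 0 1 * y 1 0 = x 0 1 * f' + u * g' := by
        rw [y10, mul_add, xu]; linear_combination (u * g') * key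
      rw [this]
      exact S.add_mem (S.mul_mem x00 y00) (S.add_mem (S.mul_mem x01 hf') (S.mul_mem hu hg'))
    · exact S.add_mem (S.mul_mem x00 y01) (S.mul_mem x01 y11)
    · exact S.add_mem (S.mul_mem x00 hw) (S.mul_mem hu y11)
    · rw [yw, xu]; ring
    · exact S.add_mem (S.mul_mem hf y00) (S.mul_mem x11 hf')
    · exact S.add_mem (S.mul_mem hg y00) (S.mul_mem x11 hg')
    · rw [x10, y10]; ring
    · have : x 1 0 * y 0 1 = f * y 0 1 + g * w := by
        rw [x10, add_mul, yw]; linear_combination (g * w) * key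
      rw [this]
      exact S.add_mem (S.add_mem (S.mul_mem hf y01) (S.mul_mem hg hw)) (S.mul_mem x11 y11)
  add_mem' {x y} hx hy := by
    obtain ⟨x00, ⟨x01, u, hu, xu⟩, ⟨f, hf, g, hg, x10⟩, x11⟩ := hx
    obtain ⟨y00, ⟨y01, w, hw, yw⟩, ⟨f', hf', g', hg', y10⟩, y11⟩ := hy
    set S := monoidRing k (latticePoints D)
    simp only [Set.mem_ofPred_eq, Matrix.add_apply]
    refine ⟨S.add_mem x00 y00, ⟨S.add_mem x01 y01, u + w, S.add_mem hu hw, ?_⟩,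
      ⟨f + f', S.add_mem hf hf', g + g', S.add_mem hg hg', ?_⟩, S.add_mem x11 y11⟩
    · rw [xu, yw]; ring
    · rw [x10, y10]; ring
  algebraMap_mem' r := by
    set S := monoidRing k (latticePoints D)
    simp only [Set.mem_ofPred_eq, Matrix.algebraMap_matrix_apply]
    refine ⟨S.algebraMap_mem r, ⟨S.zero_mem, 0, S.zero_mem, by simp⟩,
      ⟨0, S.zero_mem, 0, S.zero_mem, by simp⟩, S.algebraMap_mem r⟩

variable {k} in
theorem Lam_mono {D D' : PointedCone ℝ (Fin n → ℝ)} (h : D ≤ D') (t : Fin n → ℤ) :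
    Lam k D t ≤ Lam k D' t := by
  have hS := monoidRing_mono (k := k) (latticePoints_mono h)
  rintro x ⟨x00, ⟨x01, u, hu, xu⟩, ⟨f, hf, g, hg, x10⟩, x11⟩
  exact ⟨hS x00, ⟨hS x01, u, hS hu, xu⟩, ⟨f, hS hf, g, hS hg, x10⟩, hS x11⟩

/-- The monoid of the lattice points of degree `0` or of degree at least `s`. -/
def truncMonoid (deg : (Fin n → ℤ) →+ ℤ) (s : ℕ) : AddSubmonoid (Fin n → ℤ) where
  carrier := {m | deg m = 0 ∨ (s : ℤ) ≤ deg m}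
  zero_mem' := Or.inl (map_zero deg)
  add_mem' {a b} ha hb := by
    simp only [Set.mem_ofPred_eq, map_add] at *
    omega

/-- The `ℚ`-algebra `Λ(D, t)` as a type. -/
def LamRing (D : PointedCone ℝ (Fin n → ℝ)) (t : Fin n → ℤ) : Type _ :=
  ↥(Lam k D t)

instance (D : PointedCone ℝ (Fin n → ℝ)) (t : Fin n → ℤ) : Ring (LamRing k D t) :=
  inferInstanceAs (Ring ↥(Lam k D t))

instance (D : PointedCone ℝ (Fin n → ℝ)) (t : Fin n → ℤ) : Algebra ℚ (LamRing k D t) :=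
  inferInstanceAs (Algebra ℚ ↥(Lam k D t))

/-- The inclusion of `Λ(D, t)` into the matrix ring. -/
def lamVal (D : PointedCone ℝ (Fin n → ℝ)) (t : Fin n → ℤ) :
    LamRing k D t →ₐ[ℚ] Matrix (Fin 2) (Fin 2) (AddMonoidAlgebra k (Fin n → ℤ)) :=
  (Lam k D t).val

/-- The inclusion `Λ(D, t) ⊆ Λ(D', t)` for `D ⊆ D'`. -/
def lamInclusion {D D' : PointedCone ℝ (Fin n → ℝ)} (h : D ≤ D') (t : Fin n → ℤ) :
    LamRing k D t →ₐ[ℚ] LamRing k D' t :=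
  Subalgebra.inclusion (Lam_mono h t)

/-- The subring `Λ_[s] = Λ₀ ⊕ Λₛ ⊕ Λₛ₊₁ ⊕ ⋯` of `Λ = Λ(D, t)` for the grading of `Λ` that is
induced by `deg`: the elements of `Λ` in which only monomials of degree `0` or `≥ s` occur. -/
def LamTrunc (D : PointedCone ℝ (Fin n → ℝ)) (t : Fin n → ℤ) (deg : (Fin n → ℤ) →+ ℤ) (s : ℕ) :
    Subalgebra ℚ (LamRing k D t) :=
  ((monoidRing k (truncMonoid deg s)).restrictScalars ℚ).matrix.comap (lamVal k D t)

end Rings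

/-! ### Hochschild homology -/

section Hochschild

variable (R : Type*) [CommRing R] (A : Type*) [Ring A] [Algebra R A]

/-- The module `A ⊗ ⋯ ⊗ A` (with `n + 1` factors, over `R`) of Hochschild chains. -/
abbrev HochChain (n : ℕ) : Type _ := ⨂[R] (_ : Fin (n + 1)), A

variable {A} in
/-- `(a₀, …, aₙ₊₁) ↦ (a₀, …, aᵣaᵣ₊₁, …, aₙ₊₁)` for `r ≤ n`, and `↦ (aₙ₊₁a₀, a₁, …, aₙ)` for
`r = n + 1`. -/
def face {n : ℕ} (r : Fin (n + 2)) (a : Fin (n + 2) → A) : Fin (n + 1) → A := fun j =>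
  if (j : ℕ) = r then a j.castSucc * a j.succ
  else if (r : ℕ) = n + 1 ∧ (j : ℕ) = 0 then a (Fin.last (n + 1)) * a 0
  else if (j : ℕ) < r then a j.castSucc
  else a j.succ

variable {A} in
theorem face_update {n : ℕ} [DecidableEq (Fin (n + 2))] (r : Fin (n + 2)) (a : Fin (n + 2) → A)
    (m : Fin (n + 2)) :
    ∃ (j : Fin (n + 1)) (g : A →ₗ[R] A), ∀ x,
      face r (Function.update a m x) = Function.update (face r a) j (g x) := by
  by_cases hr : (r : ℕ) = n + 1
  · by_cases h1 : (m : ℕ) = n + 1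
    · refine ⟨0, LinearMap.mulRight R (a 0), fun x => ?_⟩
      ext j
      simp only [face, Function.update_apply, Fin.ext_iff, Fin.val_castSucc, Fin.val_succ,
        Fin.val_zero, Fin.val_last, LinearMap.mulRight_apply]
      grind
    · by_cases h2 : (m : ℕ) = 0
      · refine ⟨0, LinearMap.mulLeft R (a (Fin.last _)), fun x => ?_⟩
        ext j
        simp only [face, Function.update_apply, Fin.ext_iff, Fin.val_castSucc, Fin.val_succ,
          Fin.val_zero, Fin.val_last, LinearMap.mulLeft_apply]
        grind
      · refine ⟨⟨m, by omega⟩, LinearMap.id, fun x => ?_⟩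
        ext j
        simp only [face, Function.update_apply, Fin.ext_iff, Fin.val_castSucc, Fin.val_succ,
          Fin.val_zero, Fin.val_last, LinearMap.id_apply]
        grind
  · by_cases h1 : (m : ℕ) < r
    · refine ⟨⟨m, by omega⟩, LinearMap.id, fun x => ?_⟩
      ext j
      simp only [face, Function.update_apply, Fin.ext_iff, Fin.val_castSucc, Fin.val_succ,
        Fin.val_zero, Fin.val_last, LinearMap.id_apply]
      grind
    · by_cases h2 : (m : ℕ) = r
      · refine ⟨⟨r, by omega⟩, LinearMap.mulRight R (a ⟨r + 1, by omega⟩), fun x => ?_⟩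
        ext j
        simp only [face, Function.update_apply, Fin.ext_iff, Fin.val_castSucc, Fin.val_succ,
          Fin.val_zero, Fin.val_last, LinearMap.mulRight_apply]
        grind
      · by_cases h3 : (m : ℕ) = r + 1
        · refine ⟨⟨r, by omega⟩, LinearMap.mulLeft R (a ⟨r, r.isLt⟩), fun x => ?_⟩
          ext j
          have e : (j : ℕ) = r → a j.castSucc = a ⟨r, r.isLt⟩ := fun e => congrArg a (Fin.ext e)
          simp only [face, Function.update_apply, Fin.ext_iff, Fin.val_castSucc, Fin.val_succ,
            Fin.val_zero, Fin.val_last, LinearMap.mulLeft_apply]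
          grind
        · refine ⟨⟨m - 1, by omega⟩, LinearMap.id, fun x => ?_⟩
          ext j
          simp only [face, Function.update_apply, Fin.ext_iff, Fin.val_castSucc, Fin.val_succ,
            Fin.val_zero, Fin.val_last, LinearMap.id_apply]
          grind

variable {A} in
theorem face_face {n : ℕ} (i j : Fin (n + 2)) (hij : i ≤ j) (a : Fin (n + 3) → A) :
    face i (face j.succ a) = face j (face i.castSucc a) := by
  ext l
  obtain ⟨b, hb⟩ : ∃ b : ℕ → A, ∀ x : Fin (n + 3), a x = b x :=
    ⟨fun x => if h : x < n + 3 then a ⟨x, h⟩ else 0, fun x => by simp⟩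
  have hl := l.isLt
  have hj := j.isLt
  have hij' : (i : ℕ) ≤ j := hij
  simp only [face, hb, Fin.val_castSucc, Fin.val_succ, Fin.val_last, Fin.val_zero]
  grind [mul_assoc]

variable {A} in
theorem comp_face {B : Type*} [Ring B] [Algebra R B] (f : A →ₐ[R] B) {n : ℕ} (r : Fin (n + 2))
    (a : Fin (n + 2) → A) : (fun j => f (face r a j)) = face r (fun j => f (a j)) := by
  ext j
  simp only [face]
  split_ifs <;> simp

/-- The face map `Δᵣ : A^{⊗(n+2)} → A^{⊗(n+1)}`. -/
def hochFace (n : ℕ) (r : Fin (n + 2)) : HochChain R A (n + 1) →ₗ[R] HochChain R A n :=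
  PiTensorProduct.lift
    { toFun := fun a => PiTensorProduct.tprod R (face r a)
      map_update_add' := fun a m x y => by
        obtain ⟨j, g, h⟩ := face_update R r a m
        simp only [h, map_add, MultilinearMap.map_update_add]
      map_update_smul' := fun a m c x => by
        obtain ⟨j, g, h⟩ := face_update R r a m
        simp only [h, map_smul, MultilinearMap.map_update_smul] }

@[simp]
theorem hochFace_tprod (n : ℕ) (r : Fin (n + 2)) (a : Fin (n + 2) → A) :
    hochFace R A n r (PiTensorProduct.tprod R a) = PiTensorProduct.tprod R (face r a) := by
  rw [hochFace, PiTensorProduct.lift.tprod]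
  rfl

/-- The Hochschild differential `A^{⊗(n+2)} → A^{⊗(n+1)}`, the alternating sum of the faces. -/
def hochD (n : ℕ) : HochChain R A (n + 1) →ₗ[R] HochChain R A n :=
  ∑ r : Fin (n + 2), (-1 : R) ^ (r : ℕ) • hochFace R A n r

theorem hochD_tprod (n : ℕ) (a : Fin (n + 2) → A) :
    hochD R A n (PiTensorProduct.tprod R a) =
      ∑ r : Fin (n + 2), (-1 : R) ^ (r : ℕ) • PiTensorProduct.tprod R (face r a) := by
  simp only [hochD, LinearMap.sum_apply, LinearMap.smul_apply, hochFace_tprod]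

theorem hochD_comp_hochD (n : ℕ) : hochD R A n ∘ₗ hochD R A (n + 1) = 0 := by
  apply PiTensorProduct.ext
  apply MultilinearMap.ext
  intro a
  simp only [LinearMap.compMultilinearMap_apply, LinearMap.comp_apply, hochD_tprod, map_sum,
    map_smul, LinearMap.zero_apply, Finset.smul_sum, smul_smul]
  rw [← Finset.sum_product', Finset.univ_product_univ]
  let S : Finset (Fin (n + 3) × Fin (n + 2)) := {p | (p.1 : ℕ) ≤ (p.2 : ℕ)}
  rw [← Finset.sum_add_sum_compl S, ← eq_neg_iff_add_eq_zero, ← Finset.sum_neg_distrib]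
  refine Finset.sum_bij
    (fun p hp => (p.2.succ, p.1.castLT (lt_of_le_of_lt (Finset.mem_filter.mp hp).2 p.2.isLt)))
    ?_ ?_ ?_ ?_
  · intro p hp
    simp only [S, Finset.compl_filter, Finset.mem_filter_univ, Fin.val_succ, Fin.val_castLT] at hp ⊢
    omega
  · rintro ⟨i, j⟩ _ ⟨i', j'⟩ _ h
    simp only [Prod.mk.injEq, Fin.ext_iff, Fin.val_succ, Fin.val_castLT] at h ⊢
    omega
  · rintro ⟨i, j⟩ hp
    simp only [S, Finset.compl_filter, Finset.mem_filter_univ, not_le] at hp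
    refine ⟨(j.castSucc, ⟨i - 1, by omega⟩), ?_, ?_⟩
    · simp only [S, Finset.mem_filter_univ, Fin.val_castSucc]
      omega
    · simp only [Prod.mk.injEq, Fin.ext_iff, Fin.val_succ, Fin.val_castLT, Fin.val_castSucc,
        and_true]
      omega
  · rintro ⟨i, j⟩ hp
    have hle : (i : ℕ) ≤ j := (Finset.mem_filter.mp hp).2
    have h := face_face (i.castLT (lt_of_le_of_lt hle j.isLt)) j hle a
    rw [Fin.castSucc_castLT] at h
    simp only [h, ← neg_smul, Fin.val_succ, Fin.val_castLT]
    congr 1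
    ring

variable {A} in
/-- The map of Hochschild chains that is induced by a homomorphism of algebras. -/
def hochMap {B : Type*} [Ring B] [Algebra R B] (f : A →ₐ[R] B) (n : ℕ) :
    HochChain R A n →ₗ[R] HochChain R B n :=
  PiTensorProduct.map fun _ => f.toLinearMap

variable {A} in
theorem hochMap_tprod {B : Type*} [Ring B] [Algebra R B] (f : A →ₐ[R] B) (n : ℕ)
    (a : Fin (n + 1) → A) :
    hochMap R f n (PiTensorProduct.tprod R a) = PiTensorProduct.tprod R fun j => f (a j) := by
  rw [hochMap, PiTensorProduct.map_tprod]
  rfl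

variable {A} in
theorem hochD_comp_hochMap {B : Type*} [Ring B] [Algebra R B] (f : A →ₐ[R] B) (n : ℕ) :
    hochD R B n ∘ₗ hochMap R f (n + 1) = hochMap R f n ∘ₗ hochD R A n := by
  apply PiTensorProduct.ext
  apply MultilinearMap.ext
  intro a
  simp only [LinearMap.compMultilinearMap_apply, LinearMap.comp_apply, hochD_tprod, map_sum,
    map_smul, hochMap_tprod, comp_face]

/-! #### The quotient `C_*(A, B) = C_*(A) / C_*(B)` for a subalgebra `B` of `A` -/

variable {R A}

/-- The image of `C_n(B)` in `C_n(A)`. -/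
def subChain (B : Subalgebra R A) (n : ℕ) : Submodule R (HochChain R A n) :=
  LinearMap.range (hochMap R B.val n)

/-- The relative Hochschild chains: the cokernel of `C_n(B) → C_n(A)`. -/
abbrev RelChain (B : Subalgebra R A) (n : ℕ) : Type _ :=
  HochChain R A n ⧸ subChain B n

theorem hochD_subChain (B : Subalgebra R A) (n : ℕ) :
    subChain B (n + 1) ≤ (subChain B n).comap (hochD R A n) := by
  rintro _ ⟨x, rfl⟩
  exact ⟨hochD R B n x, (LinearMap.congr_fun (hochD_comp_hochMap R B.val n) x).symm⟩

/-- The differential of the relative Hochschild complex. -/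
def relD (B : Subalgebra R A) (n : ℕ) : RelChain B (n + 1) →ₗ[R] RelChain B n :=
  (subChain B (n + 1)).mapQ (subChain B n) (hochD R A n) (hochD_subChain B n)

theorem relD_comp_relD (B : Subalgebra R A) (n : ℕ) : relD B n ∘ₗ relD B (n + 1) = 0 := by
  apply Submodule.linearMap_qext
  apply LinearMap.ext
  intro x
  exact congrArg (subChain B n).mkQ (LinearMap.congr_fun (hochD_comp_hochD R A n) x)

/-- The relative cycles (all chains in degree `0`). -/
def relCycles (B : Subalgebra R A) : ∀ n : ℕ, Submodule R (RelChain B n)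
  | 0 => ⊤
  | n + 1 => LinearMap.ker (relD B n)

/-- The relative boundaries. -/
def relBoundaries (B : Subalgebra R A) (n : ℕ) : Submodule R (RelChain B n) :=
  LinearMap.range (relD B n)

theorem relBoundaries_le_relCycles (B : Subalgebra R A) (n : ℕ) :
    relBoundaries B n ≤ relCycles B n := by
  cases n with
  | zero => exact le_top
  | succ n =>
    rintro _ ⟨x, rfl⟩
    exact LinearMap.congr_fun (relD_comp_relD B n) x

/-- The relative Hochschild homology `HH_n(A, B) = H_n(C_*(A) / C_*(B))`. -/
def RelHH (B : Subalgebra R A) (n : ℕ) : Type _ :=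
  relCycles B n ⧸ (relBoundaries B n).submoduleOf (relCycles B n)

instance (B : Subalgebra R A) (n : ℕ) : AddCommGroup (RelHH B n) :=
  inferInstanceAs (AddCommGroup (relCycles B n ⧸ (relBoundaries B n).submoduleOf (relCycles B n)))

instance (B : Subalgebra R A) (n : ℕ) : Module R (RelHH B n) :=
  inferInstanceAs (Module R (relCycles B n ⧸ (relBoundaries B n).submoduleOf (relCycles B n)))

section Map

variable {A' : Type*} [Ring A'] [Algebra R A'] (f : A →ₐ[R] A') {B : Subalgebra R A}
  {B' : Subalgebra R A'}

theorem hochMap_subChain (hf : B ≤ B'.comap f) (n : ℕ) :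
    subChain B n ≤ (subChain B' n).comap (hochMap R f n) := by
  let g : B →ₐ[R] B' := (f.comp B.val).codRestrict B' fun b => hf b.2
  have h : hochMap R f n ∘ₗ hochMap R B.val n = hochMap R B'.val n ∘ₗ hochMap R g n := by
    apply PiTensorProduct.ext
    apply MultilinearMap.ext
    intro a
    simp only [LinearMap.compMultilinearMap_apply, LinearMap.comp_apply, hochMap_tprod]
    rfl
  rintro _ ⟨x, rfl⟩
  exact ⟨hochMap R g n x, (LinearMap.congr_fun h x).symm⟩

/-- The map `C_n(A, B) → C_n(A', B')` induced by a homomorphism `f : A → A'` with `f(B) ⊆ B'`. -/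
def relMap (hf : B ≤ B'.comap f) (n : ℕ) : RelChain B n →ₗ[R] RelChain B' n :=
  (subChain B n).mapQ (subChain B' n) (hochMap R f n) (hochMap_subChain f hf n)

theorem relD_comp_relMap (hf : B ≤ B'.comap f) (n : ℕ) :
    relD B' n ∘ₗ relMap f hf (n + 1) = relMap f hf n ∘ₗ relD B n := by
  apply Submodule.linearMap_qext
  apply LinearMap.ext
  intro x
  exact congrArg (subChain B' n).mkQ (LinearMap.congr_fun (hochD_comp_hochMap R f n) x)

theorem relMap_mem_relCycles (hf : B ≤ B'.comap f) (n : ℕ) :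
    ∀ x ∈ relCycles B n, relMap f hf n x ∈ relCycles B' n := by
  cases n with
  | zero => exact fun _ _ => Submodule.mem_top
  | succ n =>
    intro x hx
    have hx' : relD B n x = 0 := hx
    have h := LinearMap.congr_fun (relD_comp_relMap f hf n) x
    change relD B' n (relMap f hf (n + 1) x) = 0
    rw [LinearMap.comp_apply, LinearMap.comp_apply, hx', map_zero] at h
    exact h

theorem relMap_mem_relBoundaries (hf : B ≤ B'.comap f) (n : ℕ) :
    ∀ x ∈ relBoundaries B n, relMap f hf n x ∈ relBoundaries B' n := by
  rintro _ ⟨y, rfl⟩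
  exact ⟨relMap f hf (n + 1) y, LinearMap.congr_fun (relD_comp_relMap f hf n) y⟩

/-- The map `HH_n(A, B) → HH_n(A', B')` induced by a homomorphism `f : A → A'` with
`f(B) ⊆ B'`. -/
def relHHMap (hf : B ≤ B'.comap f) (n : ℕ) : RelHH B n →ₗ[R] RelHH B' n :=
  Submodule.mapQ _ _ ((relMap f hf n).restrict (relMap_mem_relCycles f hf n))
    fun x hx => relMap_mem_relBoundaries f hf n x hx

end Map

end Hochschild

/-! ### The groups `HH_i(Λ, s)` -/

section LamHH

variable (k : Type*) [Field k] [CharZero k] {n : ℕ}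

/-- `HH_i(Λ, s)` for `Λ = Λ(D, t)`: the `i`-th homology of the quotient of the Hochschild complex
of the `ℚ`-algebra `Λ` by the Hochschild complex of its subalgebra `Λ_[s]`. -/
abbrev LamHH (D : PointedCone ℝ (Fin n → ℝ)) (t : Fin n → ℤ) (deg : (Fin n → ℤ) →+ ℤ) (s i : ℕ) :
    Type _ :=
  RelHH (LamTrunc k D t deg s) i

variable {k} in
theorem LamTrunc_le_comap {D D' : PointedCone ℝ (Fin n → ℝ)} (h : D ≤ D') (t : Fin n → ℤ)
    (deg : (Fin n → ℤ) →+ ℤ) (s : ℕ) :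
    LamTrunc k D t deg s ≤
      (LamTrunc k D' t deg s).comap (lamInclusion k h t) :=
  fun _ hx => hx

/-- The map `HH_i(Λ, s) → HH_i(Λ', s)` induced by the inclusion `Λ = Λ(D, t) ⊆ Λ' = Λ(D', t)`. -/
def lamHHMap {D D' : PointedCone ℝ (Fin n → ℝ)} (h : D ≤ D') (t : Fin n → ℤ)
    (deg : (Fin n → ℤ) →+ ℤ) (s i : ℕ) :
    LamHH k D t deg s i →ₗ[ℚ] LamHH k D' t deg s i :=
  relHHMap (lamInclusion k h t) (LamTrunc_le_comap h t deg s) i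

end LamHH

end PoleRing

end

/-! Already the source `HH_i(Λ, s)` is finite dimensional, and therefore so is every image of it.

Put A = Λ and B = Λ_[s], and let X be the set of scalar matrices with the monomial (s+1)g on the
diagonal, where g runs through the nonzero generators of the cone D. These matrices are central. The
entries of Λ have nonnegative degrees (here deg t ≥ 0 enters), so multiplication by an element of X
moves everything into degrees ≥ s, that is, XA ⊂ B. By Gordan's lemma and the finiteness of k over
ℚ, A lies in a finitely generated module over the commutative algebra generated by X, so Hilbert's
basis theorem applies. It follows that A/B is finite dimensional, that A is finite over B, that B is
left Noetherian, and that every subbimodule of A ⊗ V₀ ⊗ A with dim V₀ < ∞ is a finitely generated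
bimodule (`exists_finset_generating`, `sub_fg_of_generatedOver`, `finiteDimensional_lamHH`).

These properties suffice over any field (`finiteDimensional_relHH`). Let C(A, M) be the Hochschild
complex with coefficients in a bimodule M, and consider C(B, B) ⊂ C(B, A) ⊂ C(A, A). The lower
quotient is C(B, A/B). The upper one is the case M = A of C(A, M)/C(B, M), whose homology is finite
dimensional for each finitely generated M: this follows by dimension shifting along 0 → L → A ⊗ V₀ ⊗
A → M → 0 (`Bim.FG.finPair`). For M = W ⊗ A one compares with C(B, W ⊗ B): the quotient C(A, W ⊗
A)/C(B, W ⊗ B) has no homology in positive degrees, and C(B, W ⊗ A)/C(B, W ⊗ B) = C(B, W ⊗ A/B)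
(`finPair_tens_self`).

Both reductions end with coefficients that are finitely generated on the left and are killed on the
right by a subspace of finite codimension. For these the homology of a left Noetherian algebra is
finite dimensional, by a second dimension shift along A ⊗ U → M with a finite dimensional right
module U (`Bim.finH_of_rightCofinite`). -/

noncomputable section

namespace PoleRing

universe u v

/-! ### Subspaces that are finite dimensional modulo another subspace. -/

section FinMod

variable {K V V' : Type*} [Field K] [AddCommGroup V] [Module K V] [AddCommGroup V'] [Module K V']

/-- `P` is finite dimensional modulo `Q`. -/
def FinMod (P Q : Submodule K V) : Prop := ∃ W : Submodule K V, W.FG ∧ P ≤ W ⊔ Q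

theorem FinMod.of_le {P Q : Submodule K V} (h : P ≤ Q) : FinMod P Q :=
  ⟨⊥, Submodule.fg_bot, by simpa using h⟩

theorem FinMod.mono {P P' Q Q' : Submodule K V} (h : FinMod P Q) (hP : P' ≤ P) (hQ : Q ≤ Q') :
    FinMod P' Q' := by
  obtain ⟨W, hW, h⟩ := h
  exact ⟨W, hW, hP.trans (h.trans (sup_le_sup_left hQ _))⟩

theorem FinMod.trans {P Q S : Submodule K V} (h : FinMod P Q) (h' : FinMod Q S) : FinMod P S := by
  obtain ⟨W, hW, h⟩ := h
  obtain ⟨W', hW', h'⟩ := h'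
  exact ⟨W ⊔ W', hW.sup hW', h.trans (by rw [sup_assoc]; exact sup_le_sup_left h' _)⟩

theorem FinMod.sup_right {P Q : Submodule K V} (h : FinMod P Q) (S : Submodule K V) :
    FinMod (P ⊔ S) (Q ⊔ S) := by
  obtain ⟨W, hW, h⟩ := h
  exact ⟨W, hW, sup_le (h.trans (sup_le_sup_left le_sup_left _))
    (le_sup_right.trans le_sup_right)⟩

theorem FinMod.map {P Q : Submodule K V} (h : FinMod P Q) (f : V →ₗ[K] V') :
    FinMod (P.map f) (Q.map f) := by
  obtain ⟨W, hW, h⟩ := h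
  exact ⟨W.map f, hW.map f, by rw [← Submodule.map_sup]; exact Submodule.map_mono h⟩

/-- The quotient of S ∩ f⁻¹P by S ∩ f⁻¹Q embeds into (P + Q)/Q. Since f need not be surjective, a
complement is obtained by lifting a finite generating set of the image in V'/Q. -/
theorem FinMod.inf_comap {P Q : Submodule K V'} (h : FinMod P Q) (f : V →ₗ[K] V')
    (S : Submodule K V) : FinMod (S ⊓ P.comap f) (S ⊓ Q.comap f) := by
  obtain ⟨W, hW, h⟩ := h
  set S' := S ⊓ P.comap f with hS'
  have hfg : (S'.map (Q.mkQ ∘ₗ f)).FG := by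
    have h1 : S'.map (Q.mkQ ∘ₗ f) ≤ W.map Q.mkQ := by
      rintro _ ⟨x, hx, rfl⟩
      obtain ⟨w, hw, q, hq, e⟩ := Submodule.mem_sup.1 (h hx.2)
      refine ⟨w, hw, ?_⟩
      have hq' : Q.mkQ q = 0 := (Submodule.Quotient.mk_eq_zero Q).2 hq
      rw [LinearMap.comp_apply, ← e, map_add, hq', add_zero]
    have : FiniteDimensional K (W.map Q.mkQ) := Module.Finite.iff_fg.2 (hW.map _)
    have h2 := Submodule.finiteDimensional_of_le h1
    exact Module.Finite.iff_fg.1 h2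
  obtain ⟨s, hs⟩ := hfg
  have hsub : ∀ x ∈ s, ∃ y ∈ S', (Q.mkQ ∘ₗ f) y = x := by
    intro x hx
    have : x ∈ S'.map (Q.mkQ ∘ₗ f) := hs ▸ Submodule.subset_span hx
    exact this
  choose! g hg hgs using hsub
  have hus : (Q.mkQ ∘ₗ f) '' (g '' s) = s := by
    rw [Set.image_image]
    exact (Set.image_congr hgs).trans (Set.image_id' _)
  have hu : g '' s ⊆ S' := by
    rintro _ ⟨x, hx, rfl⟩
    exact hg x hx
  set u := g '' s
  refine ⟨Submodule.span K u, Submodule.fg_span (s.finite_toSet.image g), fun x hx => ?_⟩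
  have hx' : (Q.mkQ ∘ₗ f) x ∈ (Submodule.span K u).map (Q.mkQ ∘ₗ f) := by
    rw [Submodule.map_span, hus, hs]
    exact ⟨x, hx, rfl⟩
  obtain ⟨w, hw, e⟩ := hx'
  have hwS : w ∈ S' := Submodule.span_le.2 hu hw
  refine Submodule.mem_sup.2 ⟨w, hw, x - w, ⟨S.sub_mem hx.1 hwS.1, ?_⟩, by abel⟩
  change f (x - w) ∈ Q
  rw [← Submodule.Quotient.mk_eq_zero Q]
  have e' : Q.mkQ (f w) = Q.mkQ (f x) := e
  change Q.mkQ (f (x - w)) = 0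
  rw [map_sub, map_sub, e', sub_self]

theorem FinMod.comap {P Q : Submodule K V'} (h : FinMod P Q) (f : V →ₗ[K] V') :
    FinMod (P.comap f) (Q.comap f) := by
  simpa using h.inf_comap f ⊤

theorem FinMod.inf_left {P Q : Submodule K V} (h : FinMod P Q) (S : Submodule K V) :
    FinMod (S ⊓ P) (S ⊓ Q) := by
  simpa using h.inf_comap LinearMap.id S

theorem FinMod.finiteDimensional_quotient {P Q : Submodule K V} (h : FinMod P Q) :
    FiniteDimensional K (P ⧸ Q.submoduleOf P) := by
  have h' := h.comap P.subtype
  obtain ⟨W, hW, h'⟩ := h'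
  have : Q.submoduleOf P ⊔ W = ⊤ := by
    rw [sup_comm]
    exact top_le_iff.1 (le_trans (fun x _ => x.2) h')
  have hs : W.map (Q.submoduleOf P).mkQ = ⊤ := by
    rw [← Submodule.range_mkQ, ← Submodule.map_top, ← this, Submodule.map_sup]
    simp
  exact Module.Finite.of_fg_top (hs ▸ hW.map _)

end FinMod

/-! ### Relative homology of families of submodules of a complex. -/

section Relative

variable {K : Type*} [Field K] {E : ℕ → Type*} [∀ n, AddCommGroup (E n)] [∀ n, Module K (E n)]
  (d : ∀ n, E (n + 1) →ₗ[K] E n)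

/-- The relative cycles of a pair of families of submodules of a complex. -/
def pairCycles (Y X : ∀ n, Submodule K (E n)) : ∀ n, Submodule K (E n)
  | 0 => Y 0
  | n + 1 => Y (n + 1) ⊓ (X n).comap (d n)

/-- The relative boundaries of a pair of families of submodules of a complex. -/
def pairBoundaries (Y X : ∀ n, Submodule K (E n)) (n : ℕ) : Submodule K (E n) :=
  (Y (n + 1)).map (d n) ⊔ X n

/-- The relative homology of the pair `(Y, X)` in degree `n` is finite dimensional. -/
def FinRel (Y X : ∀ n, Submodule K (E n)) (n : ℕ) : Prop :=
  FinMod (pairCycles d Y X n) (pairBoundaries d Y X n)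

variable {d}

theorem pairCycles_mono {Y X Y' X' : ∀ n, Submodule K (E n)} (hY : Y ≤ Y') (hX : X ≤ X') (n : ℕ) :
    pairCycles d Y X n ≤ pairCycles d Y' X' n := by
  cases n with
  | zero => exact hY 0
  | succ n => exact inf_le_inf (hY _) (Submodule.comap_mono (hX n))

/-- Exactness of H_n(Y/X) → H_n(Z/X) → H_n(Z/Y) in the middle. -/
theorem FinRel.trans (hd : ∀ n, d n ∘ₗ d (n + 1) = 0) {X Y Z : ∀ n, Submodule K (E n)}
    (hXY : X ≤ Y) (hYZ : Y ≤ Z) {n : ℕ} (h₁ : FinRel d Z Y n) (h₂ : FinRel d Y X n) :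
    FinRel d Z X n := by
  have a := (h₁.inf_left (pairCycles d Z X n)).mono
    (le_inf le_rfl (pairCycles_mono le_rfl hXY n)) le_rfl
  refine a.trans (FinMod.mono (h₂.sup_right ((Z (n + 1)).map (d n))) ?_ ?_)
  · rintro x ⟨hx, hx'⟩
    obtain ⟨z, hz, y, hy, rfl⟩ := Submodule.mem_sup.1 hx'
    refine Submodule.add_mem _ (Submodule.mem_sup_right hz) (Submodule.mem_sup_left ?_)
    cases n with
    | zero => exact hy
    | succ n =>
      obtain ⟨w, hw, rfl⟩ := hz
      refine ⟨hy, ?_⟩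
      have h1 : d n (d (n + 1) w + y) ∈ X n := hx.2
      have h2 : d n (d (n + 1) w) = 0 := LinearMap.congr_fun (hd n) w
      rw [map_add, h2, zero_add] at h1
      exact h1
  · refine sup_le (sup_le ?_ le_sup_right) le_sup_left
    exact (Submodule.map_mono (hYZ _)).trans le_sup_left

/-- Exactness of H_{n+1}(Z/X) → H_{n+1}(Z/Y) → H_n(Y/X) in the middle; the second map is induced by
the differential. -/
theorem FinRel.of_triple (hd : ∀ n, d n ∘ₗ d (n + 1) = 0) {X Y Z : ∀ n, Submodule K (E n)}
    (hXY : X ≤ Y) (hYZ : Y ≤ Z) {n : ℕ} (h₁ : FinRel d Z X (n + 1)) (h₂ : FinRel d Y X n) :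
    FinRel d Z Y (n + 1) := by
  have a := h₂.inf_comap (d n) (Z (n + 1))
  have b : pairCycles d Z Y (n + 1) ≤ Z (n + 1) ⊓ (pairCycles d Y X n).comap (d n) := by
    rintro z ⟨hz, hz'⟩
    refine ⟨hz, ?_⟩
    cases n with
    | zero => exact hz'
    | succ n =>
      refine ⟨hz', ?_⟩
      have : d n (d (n + 1) z) = 0 := LinearMap.congr_fun (hd n) z
      simp [this]
  refine (a.mono b le_rfl).trans (FinMod.mono (h₁.sup_right (Y (n + 1))) ?_ ?_)
  · rintro z ⟨hz, hz'⟩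
    obtain ⟨_, ⟨y, hy, rfl⟩, x, hx, e⟩ := Submodule.mem_sup.1 hz'
    -- As dz = dy + x with x in X, the chain z - y is a cycle modulo X and agrees with z modulo Y.
    refine Submodule.mem_sup.2 ⟨z - y, ⟨(Z _).sub_mem hz (hYZ _ hy), ?_⟩, y, hy, by abel⟩
    change d n (z - y) ∈ X n
    rw [map_sub, ← e, add_sub_cancel_left]
    exact hx
  · exact sup_le (sup_le le_sup_left ((hXY _).trans le_sup_right)) le_sup_right

/-- Excision: (Y + X)/X is Y/(Y ∩ X), and X₀ lies between Y ∩ X and X. -/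
theorem FinRel.sup {X X₀ Y : ∀ n, Submodule K (E n)} (hX : ∀ n, X (n + 1) ≤ (X n).comap (d n))
    (h₀ : X₀ ≤ X) (hYX : Y ⊓ X ≤ X₀) (hY : ∀ n, Y (n + 1) ≤ (Y n).comap (d n)) {n : ℕ}
    (h : FinRel d Y X₀ n) : FinRel d (Y ⊔ X) X n := by
  refine FinMod.mono (h.sup_right (X n)) ?_ ?_
  · cases n with
    | zero => exact le_rfl
    | succ n =>
      rintro z ⟨hz, hz'⟩
      obtain ⟨y, hy, x, hx, rfl⟩ := Submodule.mem_sup.1 hz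
      refine Submodule.add_mem _ (Submodule.mem_sup_left ⟨hy, hYX n ⟨hY n hy, ?_⟩⟩)
        (Submodule.mem_sup_right hx)
      have h1 : d n (y + x) ∈ X n := hz'
      rw [map_add] at h1
      exact ((X n).add_mem_iff_left (hX n hx)).1 h1
  · refine sup_le (sup_le ?_ ?_) le_sup_right
    · exact (Submodule.map_mono le_sup_left).trans le_sup_left
    · exact (h₀ n).trans le_sup_right

/-- If dx is in X, then x = d(c⁻¹s'x) - c⁻¹s(dx) is a boundary plus an element of X. The scalar c
absorbs the sign of the homotopy that is used for A ⊗ U. -/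
theorem FinRel.of_contraction (X : ∀ n, Submodule K (E n)) (n : ℕ)
    (s : E n →ₗ[K] E (n + 1)) (s' : E (n + 1) →ₗ[K] E (n + 2)) (c : K) (hc : c ≠ 0)
    (hs : ∀ x, d (n + 1) (s' x) = c • x + s (d n x)) (hX : ∀ x ∈ X n, s x ∈ X (n + 1)) :
    FinRel d ⊤ X (n + 1) := by
  refine FinMod.of_le ?_
  rintro x ⟨-, hx⟩
  have e : x = d (n + 1) (c⁻¹ • s' x) + (-c⁻¹) • s (d n x) := by
    rw [map_smul, hs, smul_add, smul_smul, inv_mul_cancel₀ hc, one_smul, neg_smul,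
      add_neg_cancel_right]
  rw [e]
  exact Submodule.add_mem_sup ⟨_, trivial, rfl⟩ (Submodule.smul_mem _ _ (hX _ hx))

variable {E' : ℕ → Type*} [∀ n, AddCommGroup (E' n)] [∀ n, Module K (E' n)]
  {d' : ∀ n, E' (n + 1) →ₗ[K] E' n}

/-- As X contains the kernel of f, the map f identifies E/X with f(E)/f(X). It transports finiteness
both along embeddings and along projections of complexes. -/
theorem finRel_map_iff (f : ∀ n, E n →ₗ[K] E' n) (hf : ∀ n x, d' n (f (n + 1) x) = f n (d n x))
    {X Y : ∀ n, Submodule K (E n)} (hX : ∀ n, LinearMap.ker (f n) ≤ X n) (n : ℕ) :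
    FinRel d' (fun n => (Y n).map (f n)) (fun n => (X n).map (f n)) n ↔ FinRel d Y X n := by
  have hb : pairBoundaries d' (fun n => (Y n).map (f n)) (fun n => (X n).map (f n)) n =
      (pairBoundaries d Y X n).map (f n) := by
    rw [pairBoundaries, pairBoundaries, Submodule.map_sup]
    congr 1
    simp only [← Submodule.map_comp]
    congr 1
    ext x
    exact hf n x
  have hker : ∀ m y, f m y ∈ (X m).map (f m) → y ∈ X m := by
    rintro m y ⟨x, hx, e⟩
    have : y - x ∈ X m := hX m (by rw [LinearMap.mem_ker, map_sub, e, sub_self])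
    simpa using (X m).add_mem this hx
  constructor
  · intro h
    refine (h.comap (f n)).mono ?_ ?_
    · cases n with
      | zero => exact fun x hx => ⟨x, hx, rfl⟩
      | succ n =>
        rintro x ⟨hx, hx'⟩
        exact ⟨⟨x, hx, rfl⟩, ⟨d n x, hx', (hf n x).symm⟩⟩
    · rw [hb, Submodule.comap_map_eq]
      exact sup_le le_rfl ((hX n).trans le_sup_right)
  · intro h
    refine (h.map (f n)).mono ?_ hb.ge
    cases n with
    | zero => exact le_rfl
    | succ n =>
      rintro _ ⟨⟨x, hx, rfl⟩, hx'⟩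
      have h1 : d' n (f (n + 1) x) ∈ (X n).map (f n) := hx'
      rw [hf] at h1
      exact ⟨x, ⟨hx, hker n _ h1⟩, rfl⟩

end Relative

/-! ### Bimodules and the Hochschild complex, built by recursion on the degree. -/

section Bimodules

variable (K : Type v) [Field K] (A : Type u) [Ring A] [Algebra K A]

/-- A right module over a `K`-algebra. -/
structure RMod where
  V : Type u
  [acg : AddCommGroup V]
  [modK : Module K V]
  rho : V →ₗ[K] A →ₗ[K] V
  rho_one : ∀ m, rho m 1 = m
  rho_mul : ∀ m a b, rho m (a * b) = rho (rho m a) b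

/-- A bimodule over a `K`-algebra. -/
structure Bim extends RMod K A where
  [modA : Module A V]
  [tower : IsScalarTower K A V]
  rho_smul : ∀ (a : A) m b, rho (a • m) b = a • rho m b

attribute [instance] RMod.acg RMod.modK Bim.modA Bim.tower

variable {K A}

/-- Homomorphisms of right modules. -/
@[ext]
structure RHom (U U' : RMod K A) where
  f : U.V →ₗ[K] U'.V
  comm : ∀ m a, f (U.rho m a) = U'.rho (f m) a

/-- Homomorphisms of bimodules. -/
@[ext]
structure BHom (M N : Bim K A) where
  f : M.V →ₗ[A] N.V
  comm : ∀ m a, f (M.rho m a) = N.rho (f m) a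

/-- A homomorphism of bimodules as a `K`-linear map. -/
abbrev BHom.lin {M N : Bim K A} (g : BHom M N) : M.V →ₗ[K] N.V := g.f.restrictScalars K

/-- The composition of homomorphisms of bimodules. -/
@[simps]
def BHom.comp {M N P : Bim K A} (g : BHom N P) (h : BHom M N) : BHom M P where
  f := g.f ∘ₗ h.f
  comm m a := by simp [h.comm, g.comm]

/-- The identity homomorphism. -/
@[simps]
def BHom.id (M : Bim K A) : BHom M M where
  f := LinearMap.id
  comm _ _ := rfl

/-- The bimodule `W ⊗ U` for a left module `W` and a right module `U`. -/
abbrev tens (W : Type u) [AddCommGroup W] [Module K W] [Module A W] [IsScalarTower K A W]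
    (U : RMod K A) : Bim K A where
  V := W ⊗[K] U.V
  rho := (LinearMap.lTensorHom W ∘ₗ U.rho.flip).flip
  rho_one m := by
    induction m with
    | zero => simp
    | add x y hx hy => rw [map_add, LinearMap.add_apply, hx, hy]
    | tmul x y => simp [U.rho_one]
  rho_mul m a b := by
    induction m with
    | zero => simp
    | add x y hx hy => simp only [map_add, LinearMap.add_apply, hx, hy]
    | tmul x y => simp [U.rho_mul]
  rho_smul a m b := by
    induction m with
    | zero => simp
    | add x y hx hy => simp only [map_add, LinearMap.add_apply, smul_add, hx, hy]
    | tmul x y => simp [TensorProduct.smul_tmul']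

theorem tens_rho_tmul (W : Type u) [AddCommGroup W] [Module K W] [Module A W] [IsScalarTower K A W]
    (U : RMod K A) (w : W) (x : U.V) (a : A) :
    (tens W U).rho (w ⊗ₜ[K] x) a = w ⊗ₜ[K] U.rho x a := rfl

theorem tens_induction {W : Type u} [AddCommGroup W] [Module K W] [Module A W]
    [IsScalarTower K A W] {U : RMod K A} {p : (tens W U).V → Prop} (m : (tens W U).V)
    (zero : p 0) (add : ∀ x y, p x → p y → p (x + y))
    (tmul : ∀ (w : W) (x : U.V), p (w ⊗ₜ[K] x)) : p m :=
  TensorProduct.induction_on m zero tmul add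

/-- The homomorphism of bimodules `W ⊗ U → W' ⊗ U'`. -/
@[simps]
def tensMap {W W' : Type u} [AddCommGroup W] [Module K W] [Module A W] [IsScalarTower K A W]
    [AddCommGroup W'] [Module K W'] [Module A W'] [IsScalarTower K A W'] {U U' : RMod K A}
    (g : W →ₗ[A] W') (h : RHom U U') : BHom (tens W U) (tens W' U') where
  f := TensorProduct.AlgebraTensorModule.map g h.f
  comm m a := by
    induction m using tens_induction with
    | zero => simp
    | add x y hx hy => simp only [map_add, LinearMap.add_apply, hx, hy]
    | tmul x y => simp [h.comm]

variable (K A) in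
/-- The algebra as a right module over itself. -/
abbrev RMod.self : RMod K A where
  V := A
  rho := LinearMap.mul K A
  rho_one := by simp
  rho_mul := by simp [mul_assoc]

variable (K A) in
/-- The algebra as a bimodule over itself. -/
abbrev Bim.self : Bim K A where
  toRMod := RMod.self K A
  modA := inferInstanceAs (Module A A)
  tower := inferInstanceAs (IsScalarTower K A A)
  rho_smul a m b := mul_assoc (a : A) m b

/-- The identity of a right module. -/
@[simps]
def RHom.id (U : RMod K A) : RHom U U where
  f := LinearMap.id
  comm _ _ := rfl

/-- The bimodule `M ⊗ A`, where `A` operates on `M` from the left and on `A` from the right. -/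
abbrev Bim.P (M : Bim K A) : Bim K A := tens M.V (RMod.self K A)

/-- The functor `M ↦ M ⊗ A` on homomorphisms of left modules. -/
abbrev pmap {W W' : Type u} [AddCommGroup W] [Module K W] [Module A W] [IsScalarTower K A W]
    [AddCommGroup W'] [Module K W'] [Module A W'] [IsScalarTower K A W'] (g : W →ₗ[A] W') :
    BHom (tens W (RMod.self K A)) (tens W' (RMod.self K A)) :=
  tensMap g (RHom.id _)

/-- The multiplication `M ⊗ A → M`. -/
def Bim.mu (M : Bim K A) : BHom M.P M where
  f :=
    { TensorProduct.lift M.rho with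
      map_smul' := fun a m => by
        induction m using tens_induction with
        | zero => simp
        | add x y hx hy => simp_all [smul_add]
        | tmul x y => simp [TensorProduct.smul_tmul', M.rho_smul] }
  comm m a := by
    induction m using tens_induction with
    | zero => simp
    | add x y hx hy => simp_all
    | tmul x y => simp [M.rho_mul]

@[simp]
theorem Bim.mu_tmul (M : Bim K A) (m : M.V) (a : A) : M.mu.f (m ⊗ₜ[K] a) = M.rho m a := rfl

/-- `C_n(A, M) = M ⊗ A ⊗ ⋯ ⊗ A`, with `n` factors `A`, as a bimodule. -/
abbrev Bim.pow : ℕ → Bim K A → Bim K A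
  | 0, M => M
  | n + 1, M => Bim.pow n M.P

/-- The homomorphism `C_n(A, M) → C_n(A, N)` that is induced by `M → N`. -/
def BHom.map : ∀ (n : ℕ) {M N : Bim K A}, BHom M N → BHom (M.pow n) (N.pow n)
  | 0, _, _, g => g
  | n + 1, _, _, g => BHom.map n (pmap g.f)

/-- `m ⊗ a ↦ ma - am`. -/
def Bim.comm (M : Bim K A) : M.P.V →ₗ[K] M.V :=
  M.mu.lin - TensorProduct.lift (Algebra.lsmul K K M.V).toLinearMap.flip

/-- The Hochschild differential `C_{n+1}(A, M) → C_n(A, M)`. -/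
def Bim.d : ∀ (n : ℕ) (M : Bim K A), (M.pow (n + 1)).V →ₗ[K] (M.pow n).V
  | 0, M => M.comm
  -- The face m ⊗ a₁ ↦ ma₁ is split off. The other faces are those of the bimodule M ⊗ A with their
  -- index shifted by one, hence the minus sign; the cyclic face is the left multiplication on M ⊗
  -- A.
  | n + 1, M => (M.mu.map (n + 1)).lin - Bim.d n M.P

end Bimodules

/-! ### Functoriality in the coefficients, and d² = 0. -/

section Bimodules

variable {K : Type v} [Field K] {A : Type u} [Ring A] [Algebra K A]

section
variable {W : Type u} [AddCommGroup W] [Module K W] [Module A W] [IsScalarTower K A W]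
  {W' : Type u} [AddCommGroup W'] [Module K W'] [Module A W'] [IsScalarTower K A W']
  {W'' : Type u} [AddCommGroup W''] [Module K W''] [Module A W''] [IsScalarTower K A W'']

theorem tens_hom_ext {U : RMod K A} {N : Bim K A} {g h : BHom (tens W U) N}
    (e : ∀ (w : W) (x : U.V), g.f (w ⊗ₜ[K] x) = h.f (w ⊗ₜ[K] x)) : g = h := by
  refine BHom.ext (LinearMap.ext fun m => ?_)
  induction m using tens_induction with
  | zero => simp
  | add x y hx hy => simp only [map_add, hx, hy]
  | tmul x y => exact e x y

theorem tensMap_tmul {U U' : RMod K A} (g : W →ₗ[A] W') (h : RHom U U') (w : W) (x : U.V) :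
    (tensMap g h).f (w ⊗ₜ[K] x) = g w ⊗ₜ[K] h.f x := rfl

theorem pmap_comp (g : W' →ₗ[A] W'') (h : W →ₗ[A] W') :
    pmap (g ∘ₗ h) = (pmap (K := K) g).comp (pmap h) :=
  tens_hom_ext fun _ _ => rfl

theorem pmap_id : pmap (LinearMap.id : W →ₗ[A] W) = BHom.id (tens W (RMod.self K A)) :=
  tens_hom_ext fun _ _ => rfl

end

theorem BHom.map_comp (n : ℕ) {M N P : Bim K A} (g : BHom N P) (h : BHom M N) :
    (g.comp h).map n = (g.map n).comp (h.map n) := by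
  induction n generalizing M N P with
  | zero => rfl
  | succ n ih =>
    rw [BHom.map, BHom.comp_f, pmap_comp, ih]
    rfl

theorem BHom.map_id (n : ℕ) (M : Bim K A) : (BHom.id M).map n = BHom.id (M.pow n) := by
  induction n generalizing M with
  | zero => rfl
  | succ n ih =>
    rw [BHom.map, BHom.id_f, pmap_id, ih]

theorem BHom.map_map (n : ℕ) {M N P : Bim K A} (g : BHom N P) (h : BHom M N) (x : (M.pow n).V) :
    (g.map n).f ((h.map n).f x) = ((g.comp h).map n).f x := by
  rw [BHom.map_comp]; rfl

theorem mu_comp_pmap {M N : Bim K A} (g : BHom M N) : N.mu.comp (pmap g.f) = g.comp M.mu :=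
  tens_hom_ext fun w x => (g.comm w x).symm

theorem Bim.comm_tmul (M : Bim K A) (m : M.V) (a : A) :
    M.comm (m ⊗ₜ[K] a) = M.rho m a - a • m := rfl

theorem Bim.d_zero (M : Bim K A) : Bim.d 0 M = M.comm := rfl

theorem Bim.d_succ (n : ℕ) (M : Bim K A) (x : (M.pow (n + 2)).V) :
    Bim.d (n + 1) M x = (M.mu.map (n + 1)).f x - Bim.d n M.P x := rfl

theorem BHom.map_succ (n : ℕ) {M N : Bim K A} (g : BHom M N) (x : (M.pow (n + 1)).V) :
    (g.map (n + 1)).f x = ((pmap g.f).map n).f x := rfl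

theorem Bim.d_map (n : ℕ) {M N : Bim K A} (g : BHom M N) (x : (M.pow (n + 1)).V) :
    Bim.d n N ((g.map (n + 1)).f x) = (g.map n).f (Bim.d n M x) := by
  induction n generalizing M N with
  | zero =>
    change N.comm ((pmap g.f).f x) = g.f (M.comm x)
    induction x using tens_induction with
    | zero => simp
    | add x y hx hy => simp only [map_add, hx, hy]
    | tmul w a =>
      rw [tensMap_tmul, Bim.comm_tmul, Bim.comm_tmul, map_sub, map_smul, g.comm]
      rfl
  | succ n ih =>
    have h : (N.mu.map (n + 1)).f ((g.map (n + 2)).f x) =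
        (g.map (n + 1)).f ((M.mu.map (n + 1)).f x) := by
      rw [BHom.map_map, ← mu_comp_pmap, BHom.map_comp]
      rfl
    rw [Bim.d_succ, Bim.d_succ, map_sub, h, BHom.map_succ (n + 1) g, ih (pmap g.f) x]
    rfl

/-- By naturality of the differential for the multiplication M ⊗ A → M the mixed terms cancel, which
leaves the identity for M ⊗ A one degree lower. Only the lowest degree needs a computation. -/
theorem Bim.d_d (n : ℕ) (M : Bim K A) : Bim.d n M ∘ₗ Bim.d (n + 1) M = 0 := by
  refine LinearMap.ext fun x => ?_
  change Bim.d n M (Bim.d (n + 1) M x) = 0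
  induction n generalizing M with
  | zero =>
    rw [Bim.d_succ, map_sub, Bim.d_zero, Bim.d_zero]
    change M.comm ((pmap M.mu.f).f x) - M.comm (M.P.comm x) = 0
    induction x using tens_induction with
    | zero => simp
    | add x y hx hy =>
      simp only [map_add]
      rw [add_sub_add_comm, hx, hy, add_zero]
    | tmul w b =>
      induction w using tens_induction with
      | zero => simp
      | add x y hx hy =>
        simp only [TensorProduct.add_tmul, map_add]
        rw [add_sub_add_comm, hx, hy, add_zero]
      | tmul m a =>
        rw [tensMap_tmul, Bim.mu_tmul, Bim.comm_tmul, Bim.comm_tmul, map_sub, tens_rho_tmul,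
          TensorProduct.smul_tmul', Bim.comm_tmul, Bim.comm_tmul, M.rho_smul, RHom.id_f]
        change _ - (M.rho m (a * b) - (a * b) • m - _) = 0
        rw [M.rho_mul, mul_smul]
        simp only [LinearMap.id_apply]
        abel
  | succ n ih =>
    rw [Bim.d_succ (n + 1), map_sub, Bim.d_map, Bim.d_succ n M (Bim.d (n + 1) M.P x), ih]
    simp

end Bimodules

/-! ### Exactness in the coefficients, and contractions for the bimodules W ⊗ A and A ⊗ U. -/

section Bimodules

variable {K : Type v} [Field K] {A : Type u} [Ring A] [Algebra K A]

section
variable {W : Type u} [AddCommGroup W] [Module K W] [Module A W] [IsScalarTower K A W]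
  {W' : Type u} [AddCommGroup W'] [Module K W'] [Module A W'] [IsScalarTower K A W']
  {W'' : Type u} [AddCommGroup W''] [Module K W''] [Module A W''] [IsScalarTower K A W'']

theorem tensMap_eq_rTensor {U : RMod K A} (g : W →ₗ[A] W') :
    ⇑(tensMap g (RHom.id U)).f = (g.restrictScalars K).rTensor U.V := rfl

/-- A homomorphism of bimodules from a tensor product, given by a `K`-linear map. -/
def tensLift {U : RMod K A} {N : Bim K A} (φ : W →ₗ[K] U.V →ₗ[K] N.V)
    (hl : ∀ (a : A) w x, φ (a • w) x = a • φ w x)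
    (hr : ∀ w x a, φ w (U.rho x a) = N.rho (φ w x) a) : BHom (tens W U) N where
  f :=
    { TensorProduct.lift φ with
      map_smul' := fun a m => by
        induction m using tens_induction with
        | zero => simp
        | add x y hx hy => simp_all [smul_add]
        | tmul x y => simp [TensorProduct.smul_tmul', hl] }
  comm m a := by
    induction m using tens_induction with
    | zero => simp
    | add x y hx hy => simp_all
    | tmul x y => simp [hr]

end

theorem BHom.map_injective (n : ℕ) {M N : Bim K A} (g : BHom M N)
    (hg : Function.Injective g.f) : Function.Injective (g.map n).f := by
  induction n generalizing M N with
  | zero => exact hg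
  | succ n ih =>
    refine ih (pmap g.f) ?_
    rw [tensMap_eq_rTensor]
    exact Module.Flat.rTensor_preserves_injective_linearMap _ hg

theorem BHom.map_surjective (n : ℕ) {M N : Bim K A} (g : BHom M N)
    (hg : Function.Surjective g.f) : Function.Surjective (g.map n).f := by
  induction n generalizing M N with
  | zero => exact hg
  | succ n ih =>
    refine ih (pmap g.f) ?_
    rw [tensMap_eq_rTensor]
    exact LinearMap.rTensor_surjective _ hg

theorem BHom.map_exact (n : ℕ) {M N P : Bim K A} (i : BHom M N) (p : BHom N P)
    (hip : Function.Exact i.f p.f) (hp : Function.Surjective p.f) :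
    Function.Exact (i.map n).f (p.map n).f := by
  induction n generalizing M N P with
  | zero => exact hip
  | succ n ih =>
    refine ih (pmap i.f) (pmap p.f) ?_ (p.map_surjective 1 hp)
    rw [tensMap_eq_rTensor, tensMap_eq_rTensor]
    exact rTensor_exact (R := K) A (f := i.lin) (g := p.lin) hip hp

/-- A subbimodule. -/
abbrev Bim.sub (M : Bim K A) (S : Submodule A M.V) (hS : ∀ m ∈ S, ∀ a, M.rho m a ∈ S) :
    Bim K A where
  V := S
  rho := LinearMap.mk₂ K (fun m a => ⟨M.rho m a, hS m m.2 a⟩)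
    (fun _ _ _ => Subtype.ext (by simp)) (fun _ _ _ => Subtype.ext (by simp))
    (fun _ _ _ => Subtype.ext (by simp)) (fun _ _ _ => Subtype.ext (by simp))
  rho_one m := Subtype.ext (M.rho_one m)
  rho_mul m a b := Subtype.ext (M.rho_mul m a b)
  rho_smul a m b := Subtype.ext (M.rho_smul a m b)

/-- The inclusion of a subbimodule. -/
@[simps]
def Bim.subHom (M : Bim K A) (S : Submodule A M.V) (hS : ∀ m ∈ S, ∀ a, M.rho m a ∈ S) :
    BHom (M.sub S hS) M where
  f := S.subtype
  comm _ _ := rfl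

/-- The kernel of a homomorphism of bimodules. -/
abbrev BHom.ker {M N : Bim K A} (g : BHom M N) : Bim K A :=
  M.sub (LinearMap.ker g.f) fun m hm a => by
    rw [LinearMap.mem_ker] at hm ⊢
    rw [g.comm, hm, map_zero, LinearMap.zero_apply]

/-- The inclusion of the kernel. -/
abbrev BHom.kerHom {M N : Bim K A} (g : BHom M N) : BHom g.ker M := M.subHom _ _

theorem BHom.exact_kerHom {M N : Bim K A} (g : BHom M N) : Function.Exact g.kerHom.f g.f :=
  LinearMap.exact_subtype_ker_map g.f

/-- In d = μ - d(M ⊗ A) the first term undoes σ and the second commutes with it. Thus a bimodule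
section of the multiplication kills the homology in positive degrees. -/
theorem Bim.d_map_section (n : ℕ) {M : Bim K A} (σ : BHom M M.P) (hσ : M.mu.comp σ = BHom.id M)
    (x : (M.pow (n + 1)).V) :
    Bim.d (n + 1) M ((σ.map (n + 1)).f x) = x - (σ.map n).f (Bim.d n M x) := by
  rw [Bim.d_succ, BHom.map_map, hσ, BHom.map_id]
  exact congrArg (x - ·) (Bim.d_map n σ x)

/-- The section `n ⊗ a ↦ n ⊗ 1 ⊗ a` of the multiplication `N ⊗ A ⊗ A → N ⊗ A`. -/
def rightSection (W : Type u) [AddCommGroup W] [Module K W] [Module A W] [IsScalarTower K A W] :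
    BHom (tens W (RMod.self K A)) (tens W (RMod.self K A)).P :=
  -- The map w ↦ w ⊗ 1 need only be left linear, because A acts from the right on the last factor
  -- alone.
  pmap
    { toFun := fun w => w ⊗ₜ[K] (1 : A)
      map_add' := fun _ _ => TensorProduct.add_tmul _ _ _
      map_smul' := fun _ _ => rfl }

theorem mu_comp_rightSection (W : Type u) [AddCommGroup W] [Module K W] [Module A W]
    [IsScalarTower K A W] :
    (tens W (RMod.self K A)).mu.comp (rightSection W) = BHom.id _ :=
  tens_hom_ext fun w a => by
    change w ⊗ₜ[K] ((1 : A) * a) = w ⊗ₜ[K] a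
    rw [one_mul]

/-- The right module `U ⊗ A`. -/
abbrev RMod.P (U : RMod K A) : RMod K A where
  V := U.V ⊗[K] A
  rho := (LinearMap.lTensorHom U.V ∘ₗ (LinearMap.mul K A).flip).flip
  rho_one m := by
    induction m with
    | zero => simp
    | add x y hx hy => rw [map_add, LinearMap.add_apply, hx, hy]
    | tmul x y => simp
  rho_mul m a b := by
    induction m with
    | zero => simp
    | add x y hx hy => simp only [map_add, LinearMap.add_apply, hx, hy]
    | tmul x y => simp [mul_assoc]

/-- The multiplication `U ⊗ A → U`. -/
def RMod.mu (U : RMod K A) : RHom U.P U where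
  f := TensorProduct.lift U.rho
  comm m a := by
    induction m using TensorProduct.induction_on with
    | zero => simp
    | add x y hx hy => simp_all
    | tmul x y => simp [U.rho_mul]

/-- The homomorphism `U ⊗ A → U' ⊗ A` that is induced by `U → U'`. -/
def RHom.pmap {U U' : RMod K A} (h : RHom U U') : RHom U.P U'.P where
  f := h.f.rTensor A
  comm m a := by
    induction m using TensorProduct.induction_on with
    | zero => simp
    | add x y hx hy => simp only [map_add, LinearMap.add_apply, hx, hy]
    | tmul x y => simp

/-- The bimodule `A ⊗ U` for a right module `U`. -/
abbrev RMod.free (U : RMod K A) : Bim K A := tens A U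

/-- The homomorphism `A ⊗ U → A ⊗ U'` that is induced by `U → U'`. -/
abbrev RHom.free {U U' : RMod K A} (h : RHom U U') : BHom U.free U'.free :=
  tensMap LinearMap.id h

/-- The associativity isomorphism `(A ⊗ U) ⊗ A → A ⊗ (U ⊗ A)`. -/
def RMod.assoc (U : RMod K A) : BHom U.free.P U.P.free where
  f := (TensorProduct.AlgebraTensorModule.assoc K K A A U.V A).toLinearMap
  comm m a := by
    induction m using tens_induction with
    | zero => simp
    | add x y hx hy => simp only [map_add, LinearMap.add_apply, hx, hy]
    | tmul x y =>
      induction x using tens_induction with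
      | zero => simp
      | add x y hx hy => simp only [TensorProduct.add_tmul, map_add, LinearMap.add_apply, hx, hy]
      | tmul x z => rfl

/-- The inverse of the associativity isomorphism. -/
def RMod.assocSymm (U : RMod K A) : BHom U.P.free U.free.P where
  f := (TensorProduct.AlgebraTensorModule.assoc K K A A U.V A).symm.toLinearMap
  comm m a := by
    induction m using tens_induction with
    | zero => simp
    | add x y hx hy => simp only [map_add, LinearMap.add_apply, hx, hy]
    | tmul x y =>
      induction y using TensorProduct.induction_on with
      | zero => simp
      | add x y hx hy => simp only [TensorProduct.tmul_add, map_add, LinearMap.add_apply, hx, hy]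
      | tmul x z => rfl

theorem RMod.assocSymm_comp_assoc (U : RMod K A) :
    U.assocSymm.comp U.assoc = BHom.id U.free.P :=
  BHom.ext (LinearMap.ext fun x =>
    (TensorProduct.AlgebraTensorModule.assoc K K A A U.V A).symm_apply_apply x)

theorem RMod.assoc_comp_assocSymm (U : RMod K A) :
    U.assoc.comp U.assocSymm = BHom.id U.P.free :=
  BHom.ext (LinearMap.ext fun x =>
    (TensorProduct.AlgebraTensorModule.assoc K K A A U.V A).apply_symm_apply x)

theorem RMod.mu_free_comp_assoc (U : RMod K A) : U.mu.free.comp U.assoc = U.free.mu := by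
  refine BHom.ext (LinearMap.ext fun m => ?_)
  induction m using tens_induction with
  | zero => simp
  | add x y hx hy => simp only [map_add, hx, hy]
  | tmul x y =>
    induction x using tens_induction with
    | zero => simp
    | add x y hx hy => simp only [TensorProduct.add_tmul, map_add, hx, hy]
    | tmul x z => rfl

theorem RHom.assoc_comp {U U' : RMod K A} (h : RHom U U') :
    U'.assoc.comp (PoleRing.pmap h.free.f) = h.pmap.free.comp U.assoc := by
  refine BHom.ext (LinearMap.ext fun m => ?_)
  induction m using tens_induction with
  | zero => simp
  | add x y hx hy => simp only [map_add, hx, hy]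
  | tmul x y =>
    induction x using tens_induction with
    | zero => simp
    | add x y hx hy => simp only [TensorProduct.add_tmul, map_add, hx, hy]
    | tmul x z => rfl

/-- The homotopy `a ⊗ u ⊗ b₁ ⊗ ⋯ ⊗ bₙ ↦ 1 ⊗ u ⊗ b₁ ⊗ ⋯ ⊗ bₙ ⊗ a`. -/
def RMod.homotopy : ∀ (n : ℕ) (U : RMod K A), (U.free.pow n).V →ₗ[K] (U.free.pow (n + 1)).V
  | 0, U => TensorProduct.lift (LinearMap.mk₂ K
      (fun (a : A) (u : U.V) => ((1 : A) ⊗ₜ[K] u) ⊗ₜ[K] a)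
      (fun _ _ _ => TensorProduct.tmul_add _ _ _) (fun _ _ _ => TensorProduct.tmul_smul _ _ _)
      (fun _ _ _ => by rw [TensorProduct.tmul_add, TensorProduct.add_tmul])
      (fun _ _ _ => by rw [TensorProduct.tmul_smul, ← TensorProduct.smul_tmul']))
  -- The coefficients (A ⊗ U) ⊗ A are again of the form A ⊗ U', with U' = U ⊗ A.
  | n + 1, U => (U.assocSymm.map (n + 1)).lin ∘ₗ RMod.homotopy n U.P ∘ₗ (U.assoc.map n).lin

theorem RMod.homotopy_succ (n : ℕ) (U : RMod K A) (x : (U.free.pow (n + 1)).V) :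
    U.homotopy (n + 1) x =
      (U.assocSymm.map (n + 1)).f (U.P.homotopy n ((U.assoc.map n).f x)) := rfl

/-- Applied to `U.mu`, this makes the homotopy commute with the first face. -/
theorem RMod.homotopy_map (n : ℕ) {U U' : RMod K A} (h : RHom U U') (x : (U.free.pow n).V) :
    U'.homotopy n ((h.free.map n).f x) = (h.free.map (n + 1)).f (U.homotopy n x) := by
  induction n generalizing U U' with
  | zero =>
    change U'.homotopy 0 (h.free.f x) = (PoleRing.pmap h.free.f).f (U.homotopy 0 x)
    induction x using tens_induction with
    | zero => simp
    | add x y hx hy => simp only [map_add, hx, hy]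
    | tmul x y => rfl
  | succ n ih =>
    rw [homotopy_succ, homotopy_succ]
    have h1 : (U'.assoc.map n).f ((h.free.map (n + 1)).f x) =
        (h.pmap.free.map n).f ((U.assoc.map n).f x) := by
      rw [BHom.map_succ, BHom.map_map, BHom.map_map, RHom.assoc_comp]
    have h2 : U'.assocSymm.comp h.pmap.free = (PoleRing.pmap h.free.f).comp U.assocSymm := by
      have e : h.pmap.free = (U'.assoc.comp (PoleRing.pmap h.free.f)).comp U.assocSymm := by
        rw [RHom.assoc_comp]
        change _ = h.pmap.free.comp (U.assoc.comp U.assocSymm)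
        rw [RMod.assoc_comp_assocSymm]
        rfl
      rw [e]
      change (U'.assocSymm.comp U'.assoc).comp ((PoleRing.pmap h.free.f).comp U.assocSymm) = _
      rw [RMod.assocSymm_comp_assoc]
      rfl
    rw [h1, ih, BHom.map_map, h2, BHom.map_comp]
    rfl

/-- The last face multiplies a back into the entry 1 and returns x, with the sign (-1)^(n+2) =
(-1)^n. Every other face commutes with the homotopy. -/
theorem RMod.d_homotopy (n : ℕ) (U : RMod K A) (x : (U.free.pow (n + 1)).V) :
    Bim.d (n + 1) U.free (U.homotopy (n + 1) x) =
      (-1 : K) ^ n • x + U.homotopy n (Bim.d n U.free x) := by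
  induction n generalizing U with
  | zero =>
    rw [pow_zero, one_smul]
    induction x using tens_induction with
    | zero => simp
    | add x y hx hy =>
      simp only [map_add]
      rw [hx, hy, add_add_add_comm]
    | tmul w b =>
      induction w using tens_induction with
      | zero => simp
      | add x y hx hy =>
        simp only [TensorProduct.add_tmul, map_add]
        rw [hx, hy, add_add_add_comm]
      | tmul a u =>
        change ((1 : A) ⊗ₜ[K] U.rho u b) ⊗ₜ[K] a -
          (((1 : A) ⊗ₜ[K] u) ⊗ₜ[K] (b * a) - ((a * 1) ⊗ₜ[K] u) ⊗ₜ[K] b) =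
            (a ⊗ₜ[K] u) ⊗ₜ[K] b + U.homotopy 0 (a ⊗ₜ[K] U.rho u b - (b * a) ⊗ₜ[K] u)
        rw [map_sub, mul_one]
        change _ = _ + (((1 : A) ⊗ₜ[K] U.rho u b) ⊗ₜ[K] a - ((1 : A) ⊗ₜ[K] u) ⊗ₜ[K] (b * a))
        abel
  | succ n ih =>
    have h1 : (U.free.mu.map (n + 2)).f (U.homotopy (n + 2) x) =
        U.homotopy (n + 1) ((U.free.mu.map (n + 1)).f x) := by
      rw [homotopy_succ, BHom.map_map, ← RMod.mu_free_comp_assoc]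
      change ((U.mu.free.comp (U.assoc.comp U.assocSymm)).map (n + 2)).f _ = _
      rw [RMod.assoc_comp_assocSymm]
      change (U.mu.free.map (n + 2)).f _ = _
      rw [← RMod.homotopy_map, BHom.map_map]
    have h2 : Bim.d (n + 1) U.free.P (U.homotopy (n + 2) x) =
        (-1 : K) ^ n • x + U.homotopy (n + 1) (Bim.d n U.free.P x) := by
      rw [homotopy_succ, Bim.d_map, ih, map_add, Bim.d_map, homotopy_succ]
      congr 1
      rw [LinearMap.map_smul_of_tower, BHom.map_map, RMod.assocSymm_comp_assoc, BHom.map_id]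
      rfl
    rw [Bim.d_succ, h1, h2, Bim.d_succ n U.free x, map_sub, pow_succ, mul_neg_one, neg_smul]
    abel

end Bimodules

/-! ### Comparison of the complexes of an algebra and of a subalgebra. -/

section Restriction

variable {K : Type v} [Field K] {A : Type u} [Ring A] [Algebra K A]

/-- The restriction of a bimodule to a subalgebra. -/
abbrev Bim.res (M : Bim K A) (B : Subalgebra K A) : Bim K B where
  V := M.V
  rho := (LinearMap.lcomp K M.V B.val.toLinearMap) ∘ₗ M.rho
  rho_one := M.rho_one
  rho_mul m a b := M.rho_mul m a b
  rho_smul a m b := M.rho_smul a m b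

/-- The restriction of a homomorphism of bimodules to a subalgebra. -/
def BHom.res {M N : Bim K A} (g : BHom M N) (B : Subalgebra K A) : BHom (M.res B) (N.res B) where
  f := g.f.restrictScalars B
  comm m a := g.comm m a

/-- The inclusion `W ⊗ B → W ⊗ A`. -/
def kap (W : Type u) [AddCommGroup W] [Module K W] [Module A W] [IsScalarTower K A W]
    (B : Subalgebra K A) :
    BHom (tens W (RMod.self K B)) ((tens W (RMod.self K A)).res B) :=
  tensLift ((LinearMap.lcomp K (W ⊗[K] A) B.val.toLinearMap) ∘ₗ TensorProduct.mk K W A)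
    (fun _ _ _ => rfl) (fun _ _ _ => rfl)

theorem kap_eq_lTensor (W : Type u) [AddCommGroup W] [Module K W] [Module A W]
    [IsScalarTower K A W] (B : Subalgebra K A) :
    (kap W B).lin = B.val.toLinearMap.lTensor W :=
  TensorProduct.ext' fun _ _ => rfl

theorem kap_injective (W : Type u) [AddCommGroup W] [Module K W] [Module A W]
    [IsScalarTower K A W] (B : Subalgebra K A) : Function.Injective (kap W B).f := by
  change Function.Injective (kap W B).lin
  rw [kap_eq_lTensor]
  exact Module.Flat.lTensor_preserves_injective_linearMap _ Subtype.val_injective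

/-- The map `C_n(B, M) → C_n(A, M)`. -/
def Bim.iota (B : Subalgebra K A) : ∀ (n : ℕ) (M : Bim K A),
    ((M.res B).pow n).V →ₗ[K] (M.pow n).V
  | 0, _ => LinearMap.id
  | n + 1, M => Bim.iota B n M.P ∘ₗ ((kap M.V B).map n).lin

theorem Bim.iota_succ (B : Subalgebra K A) (n : ℕ) (M : Bim K A) (x : ((M.res B).pow (n + 1)).V) :
    Bim.iota B (n + 1) M x = Bim.iota B n M.P (((kap M.V B).map n).f x) := rfl

theorem Bim.iota_injective (B : Subalgebra K A) (n : ℕ) (M : Bim K A) :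
    Function.Injective (Bim.iota B n M) := by
  induction n generalizing M with
  | zero => exact Function.injective_id
  | succ n ih => exact (ih M.P).comp (BHom.map_injective n _ (kap_injective M.V B))

theorem kap_comp_pmap {W : Type u} [AddCommGroup W] [Module K W] [Module A W]
    [IsScalarTower K A W] {W' : Type u} [AddCommGroup W'] [Module K W'] [Module A W']
    [IsScalarTower K A W'] (B : Subalgebra K A) (g : W →ₗ[A] W') :
    (kap W' B).comp (pmap (g.restrictScalars B)) = ((pmap (K := K) g).res B).comp (kap W B) :=
  tens_hom_ext fun _ _ => rfl

theorem Bim.iota_map (B : Subalgebra K A) (n : ℕ) {M N : Bim K A} (g : BHom M N)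
    (x : ((M.res B).pow n).V) :
    Bim.iota B n N (((g.res B).map n).f x) = (g.map n).f (Bim.iota B n M x) := by
  induction n generalizing M N with
  | zero => rfl
  | succ n ih =>
    rw [Bim.iota_succ, Bim.iota_succ, BHom.map_succ n g, ← ih, BHom.map_succ, BHom.map_map,
      BHom.map_map]
    change _ = Bim.iota B n N.P ((BHom.map n (((pmap (K := K) g.f).res B).comp (kap M.V B))).f x)
    rw [← kap_comp_pmap]
    rfl

theorem Bim.d_iota (B : Subalgebra K A) (n : ℕ) (M : Bim K A) (x : ((M.res B).pow (n + 1)).V) :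
    Bim.d n M (Bim.iota B (n + 1) M x) = Bim.iota B n M (Bim.d n (M.res B) x) := by
  induction n generalizing M with
  | zero =>
    change M.comm ((kap M.V B).f x) = (M.res B).comm x
    induction x using tens_induction with
    | zero => simp
    | add x y hx hy => simp only [map_add, hx, hy]
    | tmul m b => rfl
  | succ n ih =>
    rw [Bim.d_succ, Bim.d_succ, map_sub]
    have h1 : Bim.d n M.P (Bim.iota B (n + 2) M x) =
        Bim.iota B (n + 1) M (Bim.d n (M.res B).P x) := by
      rw [Bim.iota_succ, ih, Bim.d_map]
      rfl
    have h2 : (M.mu.map (n + 1)).f (Bim.iota B (n + 2) M x) =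
        Bim.iota B (n + 1) M (((M.res B).mu.map (n + 1)).f x) := by
      rw [Bim.iota_succ]
      have := Bim.iota_map B (n + 1) M.mu (((kap M.V B).map (n + 1)).f x)
      refine this.symm.trans ?_
      rw [BHom.map_map]
      have e : (M.mu.res B).comp (kap M.V B) = (M.res B).mu := tens_hom_ext fun _ _ => rfl
      rw [e]
    rw [h1, h2]

/-- The map `C_n(B, W ⊗ B) → C_n(A, W ⊗ A)`. -/
def iotaFree (B : Subalgebra K A) (W : Type u) [AddCommGroup W] [Module K W] [Module A W]
    [IsScalarTower K A W] (n : ℕ) :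
    ((tens W (RMod.self K B)).pow n).V →ₗ[K] ((tens W (RMod.self K A)).pow n).V :=
  Bim.iota B n _ ∘ₗ ((kap W B).map n).lin

/-- The section only inserts the factor 1, which lies in B. Hence the contraction of C(A, W ⊗ A)
preserves C(B, W ⊗ B). -/
theorem rightSection_iotaFree (B : Subalgebra K A) (W : Type u) [AddCommGroup W] [Module K W]
    [Module A W] [IsScalarTower K A W] (n : ℕ) (x : ((tens W (RMod.self K B)).pow n).V) :
    ((rightSection W).map n).f (iotaFree B W n x) =
      iotaFree B W (n + 1) (((rightSection W).map n).f x) := by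
  change ((rightSection W).map n).f (Bim.iota B n _ (((kap W B).map n).f x)) =
    Bim.iota B (n + 1) _ (((kap W B).map (n + 1)).f (((rightSection W).map n).f x))
  rw [← Bim.iota_map, Bim.iota_succ, BHom.map_succ, BHom.map_map, BHom.map_map, BHom.map_map]
  refine congrArg (fun g => Bim.iota B n (tens W (RMod.self K A)).P ((BHom.map n g).f x)) ?_
  exact tens_hom_ext fun _ _ => rfl

end Restriction

/-! ### Finiteness of Hochschild homology for coefficients with a right annihilator of finite
codimension. -/

section Finiteness

variable {K : Type v} [Field K] {A : Type u} [Ring A] [Algebra K A]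

/-- The Hochschild complex of a bimodule. -/
abbrev Bim.D (M : Bim K A) : ∀ n, (M.pow (n + 1)).V →ₗ[K] (M.pow n).V := fun n => Bim.d n M

/-- The Hochschild homology with coefficients in `M` is finite dimensional in degree `n`. -/
def Bim.FinH (M : Bim K A) (n : ℕ) : Prop :=
  FinRel (E := fun n => (M.pow n).V) M.D ⊤ ⊥ n

/-- This moves the homology of N into the complex of M, where triples of submodules can be compared.
-/
theorem BHom.finH_iff {M N : Bim K A} (p : BHom M N) (hp : Function.Surjective p.f) (n : ℕ) :
    N.FinH n ↔
      FinRel (E := fun n => (M.pow n).V) M.D ⊤ (fun n => LinearMap.ker (p.map n).lin) n := by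
  rw [← finRel_map_iff (d' := N.D) (fun n => (p.map n).lin) (fun n x => Bim.d_map n p x)
    (fun _ => le_rfl)]
  have h1 : (fun n => (⊤ : Submodule K (M.pow n).V).map (p.map n).lin) = ⊤ := by
    funext n
    rw [Submodule.map_top]
    exact LinearMap.range_eq_top.2 (p.map_surjective n hp)
  have h2 : (fun n => (LinearMap.ker (p.map n).lin).map (p.map n).lin) = ⊥ := by
    funext n
    exact LinearMap.le_ker_iff_map.1 le_rfl
  exact iff_of_eq (congrArg₂ (fun Y X => FinRel (E := fun n => (N.pow n).V) N.D Y X n)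
    h1.symm h2.symm)

/-- Exactness of H_{n+1}(M) → H_{n+1}(N) → H_n(L). -/
theorem Bim.FinH.of_exact {L M N : Bim K A} (i : BHom L M) (p : BHom M N)
    (hi : Function.Injective i.f) (hip : Function.Exact i.f p.f) (hp : Function.Surjective p.f)
    {n : ℕ} (hM : M.FinH (n + 1)) (hL : L.FinH n) : N.FinH (n + 1) := by
  rw [p.finH_iff hp]
  refine FinRel.of_triple (fun n => Bim.d_d n M) bot_le le_top hM ?_
  have h := (finRel_map_iff (d' := M.D) (fun n => (i.map n).lin) (fun n x => Bim.d_map n i x)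
    (X := ⊥) (Y := ⊤)
    (fun n => (LinearMap.ker_eq_bot.2 (i.map_injective n hi)).le) n).2 hL
  have h1 : (fun n => (⊤ : Submodule K (L.pow n).V).map (i.map n).lin) =
      fun n => LinearMap.ker (p.map n).lin := by
    funext n
    rw [Submodule.map_top]
    exact (LinearMap.exact_iff (f := (i.map n).lin) (g := (p.map n).lin)).1
      (i.map_exact n p hip hp) |>.symm
  have h2 : (fun n => (⊥ : Submodule K (L.pow n).V).map (i.map n).lin) = ⊥ := by
    funext n
    exact Submodule.map_bot _
  rw [← h1, ← h2]
  exact h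

theorem RMod.finH_free (U : RMod K A) (n : ℕ) : U.free.FinH (n + 1) :=
  FinRel.of_contraction ⊥ n (U.homotopy n) (U.homotopy (n + 1)) ((-1) ^ n)
    (pow_ne_zero _ (by simp)) (fun x => U.d_homotopy n x) (fun x hx => by
      have : x = 0 := hx
      rw [this, map_zero]
      exact zero_mem _)

/-- The right annihilator of `M` has finite codimension. -/
def Bim.RightCofinite (M : Bim K A) : Prop :=
  ∃ J : Submodule K A, FiniteDimensional K (A ⧸ J) ∧ ∀ m, ∀ j ∈ J, M.rho m j = 0

theorem exists_fg_sup_eq_top {V : Type*} [AddCommGroup V] [Module K V] (J : Submodule K V)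
    [FiniteDimensional K (V ⧸ J)] : ∃ W : Submodule K V, W.FG ∧ W ⊔ J = ⊤ := by
  obtain ⟨W, hW⟩ := Submodule.exists_isCompl J
  refine ⟨W, ?_, hW.symm.sup_eq_top⟩
  exact Module.Finite.iff_fg.1 (Module.Finite.equiv (Submodule.quotientEquivOfIsCompl J W hW))

theorem Bim.RightCofinite.fg_range {M : Bim K A} (h : M.RightCofinite) (m : M.V) :
    (LinearMap.range (M.rho m)).FG := by
  obtain ⟨J, hJ, h⟩ := h
  obtain ⟨W, hW, e⟩ := exists_fg_sup_eq_top J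
  have : LinearMap.range (M.rho m) = W.map (M.rho m) := by
    rw [← Submodule.map_top, ← e, Submodule.map_sup, sup_eq_left]
    rintro _ ⟨j, hj, rfl⟩
    rw [h m j hj]
    exact zero_mem _
  rw [this]
  exact hW.map _

/-- If gj = 0, then jg = -(gj - jg) is a commutator. So modulo commutators M is spanned by the
elements wg, with g in a finite set of left generators and w in a finite dimensional complement of
J. -/
theorem Bim.finH_zero_of_rightCofinite (M : Bim K A) (hM : Module.Finite A M.V)
    (h : M.RightCofinite) : M.FinH 0 := by
  obtain ⟨J, hJ, h⟩ := h
  obtain ⟨W, hW, e⟩ := exists_fg_sup_eq_top J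
  obtain ⟨G, hG⟩ := hM
  refine ⟨⨆ g ∈ G, W.map ((LinearMap.toSpanSingleton A M.V g).restrictScalars K),
    Submodule.fg_biSup G _ fun g _ => hW.map _, ?_⟩
  intro m _
  have hm : m ∈ Submodule.span A (G : Set M.V) := hG ▸ Submodule.mem_top
  obtain ⟨c, -, rfl⟩ := Submodule.mem_span_finset.1 hm
  refine Submodule.sum_mem _ fun g hg => ?_
  obtain ⟨w, hw, j, hj, hc⟩ := Submodule.mem_sup.1 (e ▸ Submodule.mem_top : c g ∈ W ⊔ J)
  rw [← hc, add_smul]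
  refine Submodule.add_mem_sup (Submodule.mem_iSup_of_mem g (Submodule.mem_iSup_of_mem hg
    ⟨w, hw, rfl⟩)) (Submodule.mem_sup_left ⟨-(g ⊗ₜ[K] j), trivial, ?_⟩)
  change M.comm (-(g ⊗ₜ[K] j)) = j • g
  rw [map_neg, Bim.comm_tmul, h g j hj, zero_sub, neg_neg]

theorem finite_tensor (W U : Type*) [AddCommGroup W] [Module K W] [Module A W]
    [IsScalarTower K A W] [AddCommGroup U] [Module K U] [Module.Finite A W] [Module.Finite K U] :
    Module.Finite A (W ⊗[K] U) := by
  classical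
  obtain ⟨s, hs⟩ := Module.Finite.fg_top (R := A) (M := W)
  obtain ⟨t, ht⟩ := Module.Finite.fg_top (R := K) (M := U)
  refine ⟨⟨Finset.image₂ (fun w u => w ⊗ₜ[K] u) s t, Submodule.eq_top_iff'.2 fun x => ?_⟩⟩
  induction x with
  | zero => exact zero_mem _
  | add x y hx hy => exact add_mem hx hy
  | tmul w u =>
    have hw : w ∈ Submodule.span A (s : Set W) := hs ▸ Submodule.mem_top
    have hu : u ∈ Submodule.span K (t : Set U) := ht ▸ Submodule.mem_top
    induction hw using Submodule.span_induction with
    | zero => simp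
    | add x y _ _ hx hy => rw [TensorProduct.add_tmul]; exact add_mem hx hy
    | smul a x _ hx => rw [← TensorProduct.smul_tmul']; exact Submodule.smul_mem _ a hx
    | mem w hw =>
      induction hu using Submodule.span_induction with
      | zero => simp
      | add x y _ _ hx hy => rw [TensorProduct.tmul_add]; exact add_mem hx hy
      | smul a x _ hx =>
        rw [TensorProduct.tmul_smul, ← algebraMap_smul A a]
        exact Submodule.smul_mem _ _ hx
      | mem u hu => exact Submodule.subset_span (Finset.mem_image₂_of_mem hw hu)

theorem Bim.RightCofinite.sub {M : Bim K A} (h : M.RightCofinite) (S : Submodule A M.V) (hS) :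
    (M.sub S hS).RightCofinite := by
  obtain ⟨J, hJ, h⟩ := h
  exact ⟨J, hJ, fun m j hj => Subtype.ext (h m j hj)⟩

theorem Bim.rightCofinite_of_finiteDimensional (M : Bim K A) [FiniteDimensional K M.V] :
    M.RightCofinite :=
  ⟨LinearMap.ker M.rho.flip, Module.Finite.equiv (LinearMap.quotKerEquivRange M.rho.flip).symm,
    fun m _ hj => LinearMap.congr_fun (LinearMap.mem_ker.1 hj) m⟩

theorem rightCofinite_tens (W : Type u) [AddCommGroup W] [Module K W] [Module A W]
    [IsScalarTower K A W] (U : RMod K A) [FiniteDimensional K U.V] :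
    (tens W U).RightCofinite := by
  refine ⟨LinearMap.ker U.rho.flip, ?_, fun m j hj => ?_⟩
  · exact Module.Finite.equiv (LinearMap.quotKerEquivRange U.rho.flip).symm
  · induction m using tens_induction with
    | zero => simp
    | add x y hx hy => rw [map_add, LinearMap.add_apply, hx, hy, add_zero]
    | tmul w x =>
      have : U.rho x j = 0 := LinearMap.congr_fun (LinearMap.mem_ker.1 hj) x
      rw [tens_rho_tmul, this, TensorProduct.tmul_zero]

/-- A submodule of a right module. -/
abbrev RMod.sub (U : RMod K A) (S : Submodule K U.V) (hS : ∀ m ∈ S, ∀ a, U.rho m a ∈ S) :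
    RMod K A where
  V := S
  rho := LinearMap.mk₂ K (fun m a => ⟨U.rho m a, hS m m.2 a⟩)
    (fun _ _ _ => Subtype.ext (by simp)) (fun _ _ _ => Subtype.ext (by simp))
    (fun _ _ _ => Subtype.ext (by simp)) (fun _ _ _ => Subtype.ext (by simp))
  rho_one m := Subtype.ext (U.rho_one m)
  rho_mul m a b := Subtype.ext (U.rho_mul m a b)

/-- The right submodule U generated by finitely many left generators of M is finite dimensional,
since each map a ↦ ga factors through A/J. -/
theorem Bim.RightCofinite.exists_cover {M : Bim K A} (h : M.RightCofinite)
    (hM : Module.Finite A M.V) : ∃ (U : RMod K A) (_ : FiniteDimensional K U.V)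
      (p : BHom U.free M), Function.Surjective p.f := by
  obtain ⟨G, hG⟩ := hM
  let S : Submodule K M.V := ⨆ g ∈ G, LinearMap.range (M.rho g)
  have hS : ∀ m ∈ S, ∀ a, M.rho m a ∈ S := by
    intro m hm a
    have : S ≤ S.comap (M.rho.flip a) := by
      refine iSup₂_le fun g hg => ?_
      rintro _ ⟨b, rfl⟩
      change M.rho (M.rho g b) a ∈ S
      rw [← M.rho_mul]
      exact Submodule.mem_iSup_of_mem g (Submodule.mem_iSup_of_mem hg ⟨_, rfl⟩)
    exact this hm
  have hfg : S.FG := Submodule.fg_biSup G _ fun g _ => h.fg_range g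
  refine ⟨M.toRMod.sub S hS, Module.Finite.iff_fg.2 hfg, tensLift
    ((Algebra.lsmul K K M.V).toLinearMap.compl₂ S.subtype)
    (fun a w x => mul_smul a w (x : M.V)) (fun w x a => (M.rho_smul w x a).symm), ?_⟩
  rw [← LinearMap.range_eq_top, ← top_le_iff, ← hG, Submodule.span_le]
  intro g hg
  have hgS : g ∈ S := Submodule.mem_iSup_of_mem g (Submodule.mem_iSup_of_mem hg
    ⟨1, M.rho_one g⟩)
  exact ⟨(1 : A) ⊗ₜ[K] (⟨g, hgS⟩ : S), one_smul A g⟩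

/-- Dimension shifting along A ⊗ U → M, where A ⊗ U has no homology in positive degrees. The kernel
is finitely generated as A is left Noetherian, and it is killed from the right by the annihilator of
the finite dimensional U. -/
theorem Bim.finH_of_rightCofinite [IsNoetherianRing A] (n : ℕ) (M : Bim K A)
    (hM : Module.Finite A M.V) (h : M.RightCofinite) : M.FinH n := by
  induction n generalizing M with
  | zero => exact M.finH_zero_of_rightCofinite hM h
  | succ n ih =>
    obtain ⟨U, hU, p, hp⟩ := h.exists_cover hM
    refine .of_exact p.kerHom p Subtype.val_injective p.exact_kerHom hp (U.finH_free n) (ih _ ?_ ?_)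
    · have : Module.Finite A U.free.V := finite_tensor (K := K) A U.V
      exact Module.Finite.of_fg (IsNoetherian.noetherian (R := A) (LinearMap.ker p.f))
    · exact (rightCofinite_tens A U).sub _ _

end Finiteness

/-! ### Relative homology of a pair of algebras with coefficients in a bimodule. -/

section Pairs

variable {K : Type v} [Field K] {A : Type u} [Ring A] [Algebra K A]

/-- The homomorphism `m ↦ mb` of left modules. -/
def Bim.rmul (M : Bim K A) (b : A) : M.V →ₗ[A] M.V where
  toFun m := M.rho m b
  map_add' _ _ := by simp
  map_smul' a m := M.rho_smul a m b

theorem BHom.range_rmul {M N : Bim K A} (g : BHom M N) (b : A) :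
    LinearMap.range g.f ≤ (LinearMap.range g.f).comap (N.rmul b) := by
  rintro _ ⟨m, rfl⟩
  exact ⟨M.rho m b, g.comm m b⟩

/-- The cokernel of a homomorphism of bimodules. -/
abbrev BHom.coker {M N : Bim K A} (g : BHom M N) : Bim K A where
  V := N.V ⧸ LinearMap.range g.f
  rho := LinearMap.mk₂ K
    (fun m b => (LinearMap.range g.f).mapQ (LinearMap.range g.f) (N.rmul b) (g.range_rmul b) m)
    (fun _ _ _ => map_add _ _ _) (fun _ _ _ => LinearMap.map_smul_of_tower _ _ _)
    (fun m a b => by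
      obtain ⟨m, rfl⟩ := Submodule.Quotient.mk_surjective _ m
      exact congrArg (Submodule.Quotient.mk (p := LinearMap.range g.f)) (map_add (N.rho m) a b))
    (fun c m b => by
      obtain ⟨m, rfl⟩ := Submodule.Quotient.mk_surjective _ m
      exact congrArg (Submodule.Quotient.mk (p := LinearMap.range g.f)) (map_smul (N.rho m) c b))
  rho_one m := by
    obtain ⟨m, rfl⟩ := Submodule.Quotient.mk_surjective _ m
    exact congrArg (Submodule.Quotient.mk (p := LinearMap.range g.f)) (N.rho_one m)
  rho_mul m a b := by
    obtain ⟨m, rfl⟩ := Submodule.Quotient.mk_surjective _ m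
    exact congrArg (Submodule.Quotient.mk (p := LinearMap.range g.f)) (N.rho_mul m a b)
  rho_smul a m b :=
    ((LinearMap.range g.f).mapQ (LinearMap.range g.f) (N.rmul b) (g.range_rmul b)).map_smul a m

/-- The projection onto the cokernel. -/
def BHom.cokerHom {M N : Bim K A} (g : BHom M N) : BHom N g.coker where
  f := (LinearMap.range g.f).mkQ
  comm _ _ := rfl

theorem BHom.exact_cokerHom {M N : Bim K A} (g : BHom M N) : Function.Exact g.f g.cokerHom.f :=
  LinearMap.exact_map_mkQ_range g.f

theorem BHom.cokerHom_surjective {M N : Bim K A} (g : BHom M N) :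
    Function.Surjective g.cokerHom.f :=
  Submodule.mkQ_surjective _

theorem BHom.finRel_range {L M N : Bim K A} (i : BHom L M) (p : BHom M N)
    (hip : Function.Exact i.f p.f) (hp : Function.Surjective p.f) {n : ℕ} (hN : N.FinH n) :
    FinRel (E := fun n => (M.pow n).V) M.D ⊤ (fun n => LinearMap.range (i.map n).lin) n := by
  have h : (fun n => LinearMap.range (i.map n).lin) = fun n => LinearMap.ker (p.map n).lin := by
    funext n
    exact ((LinearMap.exact_iff (f := (i.map n).lin) (g := (p.map n).lin)).1
      (i.map_exact n p hip hp)).symm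
  rw [h]
  exact (p.finH_iff hp n).1 hN

/-- The relative Hochschild homology of the pair `(A, B)` with coefficients in `M` is finite
dimensional in degree `n`. -/
def Bim.FinPair (B : Subalgebra K A) (M : Bim K A) (n : ℕ) : Prop :=
  FinRel (E := fun n => (M.pow n).V) M.D ⊤ (fun n => LinearMap.range (Bim.iota B n M)) n

theorem Bim.finPair_zero (B : Subalgebra K A) (M : Bim K A) : M.FinPair B 0 :=
  FinMod.of_le fun x _ => Submodule.mem_sup_right ⟨x, rfl⟩

theorem Bim.range_iota_le_comap (B : Subalgebra K A) (M : Bim K A) (n : ℕ) :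
    LinearMap.range (Bim.iota B (n + 1) M) ≤ (LinearMap.range (Bim.iota B n M)).comap (M.D n) := by
  rintro _ ⟨x, rfl⟩
  exact ⟨_, (Bim.d_iota B n M x).symm⟩

/-- The quotients C(A, -)/C(B, -) of L, M and N form a short exact sequence of complexes, because
C(A, L) ∩ C(B, M) = C(B, L) inside C(A, M). -/
theorem Bim.FinPair.of_exact {B : Subalgebra K A} {L M N : Bim K A} (i : BHom L M) (p : BHom M N)
    (hi : Function.Injective i.f) (hip : Function.Exact i.f p.f) (hp : Function.Surjective p.f)
    {n : ℕ} (hM : M.FinPair B (n + 1)) (hL : L.FinPair B n) : N.FinPair B (n + 1) := by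
  let X : ∀ n, Submodule K (M.pow n).V := fun n => LinearMap.range (Bim.iota B n M)
  let Y : ∀ n, Submodule K (M.pow n).V := fun n => LinearMap.range (i.map n).lin
  let X₀ : ∀ n, Submodule K (M.pow n).V :=
    fun n => (LinearMap.range (Bim.iota B n L)).map (i.map n).lin
  have hYker : ∀ n, Y n = LinearMap.ker (p.map n).lin := fun n =>
    ((LinearMap.exact_iff (f := (i.map n).lin) (g := (p.map n).lin)).1
      (i.map_exact n p hip hp)).symm
  have h0 : FinRel (E := fun n => (M.pow n).V) M.D Y X₀ n := by
    have h := (finRel_map_iff (d' := M.D) (fun n => (i.map n).lin)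
      (fun n x => Bim.d_map n i x) (Y := ⊤)
      (fun n => (LinearMap.ker_eq_bot (f := (i.map n).lin).2 (i.map_injective n hi)).le.trans
        bot_le) n).2 hL
    have e : Y = fun n => (⊤ : Submodule K (L.pow n).V).map (i.map n).lin := by
      funext n
      exact (Submodule.map_top _).symm
    rw [e]
    exact h
  have h1 : FinRel (E := fun n => (M.pow n).V) M.D (Y ⊔ X) X n := by
    refine FinRel.sup (M.range_iota_le_comap B) ?_ ?_ ?_ h0
    · rintro n _ ⟨_, ⟨x, rfl⟩, rfl⟩
      exact ⟨((i.res B).map n).f x, Bim.iota_map B n i x⟩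
    -- A chain of C(B, M) that vanishes in C(A, N) already vanishes in C(B, N), by injectivity of
    -- `Bim.iota`, and so it comes from C(B, L).
    · rintro n x ⟨hx, ⟨z, rfl⟩⟩
      rw [hYker] at hx
      have hz : (p.map n).f (Bim.iota B n M z) = 0 := hx
      rw [← Bim.iota_map] at hz
      have hz' : ((p.res B).map n).f z = 0 :=
        Bim.iota_injective B n N (hz.trans (map_zero _).symm)
      obtain ⟨w, rfl⟩ := ((i.res B).map_exact n (p.res B) hip hp z).1 hz'
      exact ⟨_, ⟨w, rfl⟩, (Bim.iota_map B n i w).symm⟩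
    · rintro n _ ⟨x, rfl⟩
      exact ⟨Bim.d n L x, (Bim.d_map n i x).symm⟩
  have h2 := FinRel.of_triple (fun n => Bim.d_d n M) (le_sup_right : X ≤ Y ⊔ X) le_top hM h1
  -- Modulo C(A, L), the sum C(A, L) + C(B, M) becomes C(B, N).
  have h3 := (finRel_map_iff (d' := N.D) (fun n => (p.map n).lin) (fun n x => Bim.d_map n p x)
    (fun n => (hYker n).ge.trans le_sup_left) (n + 1)).2 h2
  have e1 : (fun n => (⊤ : Submodule K (M.pow n).V).map (p.map n).lin) = ⊤ := by
    funext n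
    rw [Submodule.map_top]
    exact LinearMap.range_eq_top.2 (p.map_surjective n hp)
  have e2 : (fun n => (Y n ⊔ X n).map (p.map n).lin) =
      fun n => LinearMap.range (Bim.iota B n N) := by
    funext n
    rw [Submodule.map_sup, hYker, LinearMap.le_ker_iff_map.1 le_rfl, bot_sup_eq]
    ext y
    constructor
    · rintro ⟨_, ⟨x, rfl⟩, rfl⟩
      exact ⟨_, Bim.iota_map B n p x⟩
    · rintro ⟨y, rfl⟩
      obtain ⟨x, rfl⟩ := (p.res B).map_surjective n hp y
      exact ⟨_, ⟨x, rfl⟩, (Bim.iota_map B n p x).symm⟩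
  exact (congrArg₂ (fun Y X => FinRel (E := fun n => (N.pow n).V) N.D Y X (n + 1)) e1 e2).mp h3

/-- The inclusion of a subalgebra as a homomorphism of bimodules over the subalgebra. -/
def selfRes (B : Subalgebra K A) : BHom (Bim.self K B) ((Bim.self K A).res B) where
  f := { B.val.toLinearMap with map_smul' := fun _ _ => rfl }
  comm _ _ := rfl

theorem lTensor_smul_subalgebra (W : Type u) [AddCommGroup W] [Module K W] [Module A W]
    [IsScalarTower K A W] (B : Subalgebra K A) {U U' : Type u} [AddCommGroup U] [Module K U]
    [AddCommGroup U'] [Module K U'] (g : U →ₗ[K] U') (b : B) (m : W ⊗[K] U) :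
    g.lTensor W ((b : A) • m) = b • g.lTensor W m := by
  induction m using TensorProduct.induction_on with
  | zero => simp
  | add x y hx hy => rw [smul_add, map_add, hx, hy, map_add, smul_add]
  | tmul w x => rfl

/-- The projection `W ⊗ A → W ⊗ (A/B)`. -/
def tensCoker (W : Type u) [AddCommGroup W] [Module K W] [Module A W] [IsScalarTower K A W]
    (B : Subalgebra K A) :
    BHom ((tens W (RMod.self K A)).res B) (tens W (selfRes B).coker.toRMod) where
  f :=
    { (selfRes B).cokerHom.lin.lTensor W with
      map_smul' := fun b m => lTensor_smul_subalgebra W B _ b m }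
  comm m a := by
    induction m using TensorProduct.induction_on with
    | zero => simp
    | add x y hx hy => simp_all
    | tmul w x => rfl

theorem exact_tensCoker (W : Type u) [AddCommGroup W] [Module K W] [Module A W]
    [IsScalarTower K A W] (B : Subalgebra K A) :
    Function.Exact (kap W B).f (tensCoker W B).f := by
  change Function.Exact (kap W B).lin ((selfRes B).cokerHom.lin.lTensor W)
  rw [kap_eq_lTensor]
  exact lTensor_exact (R := K) W (f := (selfRes B).lin) (g := (selfRes B).cokerHom.lin)
    (selfRes B).exact_cokerHom (selfRes B).cokerHom_surjective

theorem tensCoker_surjective (W : Type u) [AddCommGroup W] [Module K W] [Module A W]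
    [IsScalarTower K A W] (B : Subalgebra K A) : Function.Surjective (tensCoker W B).f :=
  LinearMap.lTensor_surjective (R := K) W (g := (selfRes B).cokerHom.lin)
    (selfRes B).cokerHom_surjective

/-- In the triple C(B, W ⊗ B) ⊂ C(B, W ⊗ A) ⊂ C(A, W ⊗ A) the outer quotient is contracted by
`rightSection`. The lower quotient is C(B, W ⊗ A/B), whose coefficients are finite over B on the
left and carry a right action on the finite dimensional factor A/B. -/
theorem finPair_tens_self (B : Subalgebra K A) [IsNoetherianRing B] (W : Type u) [AddCommGroup W]
    [Module K W] [Module A W] [IsScalarTower K A W] [Module.Finite B W]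
    [FiniteDimensional K (selfRes B).coker.V] (n : ℕ) :
    (tens W (RMod.self K A)).FinPair B (n + 1) := by
  set F := tens W (RMod.self K A) with hF
  let X' : ∀ n, Submodule K (F.pow n).V := fun n => LinearMap.range (iotaFree B W n)
  have h1 : FinRel (E := fun n => (F.pow n).V) F.D ⊤ X' (n + 1) := by
    -- The section σ satisfies dσ = 1 - σd, so the homotopy in the lower degree is -σ.
    refine FinRel.of_contraction X' n (-((rightSection W).map n).lin)
      ((rightSection W).map (n + 1)).lin 1 one_ne_zero (fun x => ?_) ?_
    · refine (Bim.d_map_section n _ (mu_comp_rightSection W) x).trans ?_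
      rw [one_smul, LinearMap.neg_apply, sub_eq_add_neg]
      rfl
    · rintro _ ⟨x, rfl⟩
      refine (X' (n + 1)).neg_mem ⟨_, (rightSection_iotaFree B W n x).symm⟩
  have h2 : (tens W (selfRes B).coker.toRMod).FinH n :=
    Bim.finH_of_rightCofinite n _ (finite_tensor (K := K) W _) (rightCofinite_tens W _)
  have h3 := (kap W B).finRel_range _ (exact_tensCoker W B) (tensCoker_surjective W B) h2
  have h4 := (finRel_map_iff (d' := F.D) (fun n => Bim.iota B n F) (fun n x => Bim.d_iota B n F x)
    (fun n => (LinearMap.ker_eq_bot.2 (Bim.iota_injective B n F)).le.trans bot_le) n).2 h3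
  refine FinRel.of_triple (X := X') (fun n => Bim.d_d n F) ?_ le_top h1 ?_
  · rintro n _ ⟨x, rfl⟩
    exact ⟨_, rfl⟩
  · have e1 : (fun n => (⊤ : Submodule K ((F.res B).pow n).V).map (Bim.iota B n F)) =
        fun n => LinearMap.range (Bim.iota B n F) := by
      funext n
      exact Submodule.map_top _
    have e2 : (fun n => (LinearMap.range ((kap W B).map n).lin).map (Bim.iota B n F)) = X' := by
      funext n
      exact (LinearMap.range_comp _ _).symm
    exact (congrArg₂ (fun Y X => FinRel (E := fun n => (F.pow n).V) F.D Y X n) e1 e2).mp h4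

/-- The bimodule `M` is finitely generated. -/
def Bim.FG (M : Bim K A) : Prop :=
  ∃ G : Finset M.V, ∀ S : Submodule A M.V, (∀ m ∈ S, ∀ a, M.rho m a ∈ S) → (G : Set M.V) ⊆ S → S = ⊤

/-- The homomorphism `A ⊗ V₀ → V` of left modules for a subspace `V₀ ⊆ V`. -/
def spanLift {V : Type u} [AddCommGroup V] [Module K V] [Module A V] [IsScalarTower K A V]
    (V₀ : Submodule K V) : A ⊗[K] V₀ →ₗ[A] V :=
  { TensorProduct.lift ((Algebra.lsmul K K V).toLinearMap.compl₂ V₀.subtype) with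
    map_smul' := fun a m => by
      induction m using TensorProduct.induction_on with
      | zero => simp
      | add x y hx hy => simp_all [smul_add]
      | tmul b x => exact mul_smul a b (x : V) }

theorem Bim.FG.exists_cover {M : Bim K A} (h : M.FG) :
    ∃ (V₀ : Submodule K M.V) (_ : FiniteDimensional K V₀)
      (p : BHom (tens (A ⊗[K] V₀) (RMod.self K A)) M), Function.Surjective p.f := by
  obtain ⟨G, hG⟩ := h
  refine ⟨Submodule.span K G, .span_finset K G, M.mu.comp (pmap (spanLift _)), ?_⟩
  rw [← LinearMap.range_eq_top]
  refine hG _ ?_ ?_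
  · rintro _ ⟨m, rfl⟩ a
    exact ⟨_, (BHom.comm _ m a)⟩
  · intro g hg
    refine ⟨((1 : A) ⊗ₜ[K] (⟨g, Submodule.subset_span hg⟩ : Submodule.span K (G : Set M.V)))
      ⊗ₜ[K] (1 : A), ?_⟩
    change M.rho ((1 : A) • g) 1 = g
    rw [one_smul, M.rho_one]

/-- Dimension shifting along A ⊗ V₀ ⊗ A → M; by `hA` the kernels stay finitely generated. The
induction starts because C₀(B, M) = M = C₀(A, M). -/
theorem Bim.FG.finPair (B : Subalgebra K A) [IsNoetherianRing B] [Module.Finite B A]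
    [FiniteDimensional K (selfRes B).coker.V]
    (hA : ∀ (V₀ : Type u) [AddCommGroup V₀] [Module K V₀] [FiniteDimensional K V₀]
      (S : Submodule A (tens (A ⊗[K] V₀) (RMod.self K A)).V) (hS), ((tens _ _).sub S hS).FG)
    (n : ℕ) {M : Bim K A} (hM : M.FG) : M.FinPair B n := by
  induction n generalizing M with
  | zero => exact M.finPair_zero B
  | succ n ih =>
    obtain ⟨V₀, hV₀, p, hp⟩ := hM.exists_cover
    have : Module.Finite B (A ⊗[K] V₀) := .trans A _
    exact .of_exact p.kerHom p Subtype.val_injective p.exact_kerHom hp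
      (finPair_tens_self B (A ⊗[K] V₀) n) (ih (hA V₀ _ _))

/-- In C(B, B) ⊂ C(B, A) ⊂ C(A, A) the lower quotient is C(B, A/B) with finite dimensional
coefficients, and the upper one belongs to the bimodule A, which is generated by 1. -/
theorem finRel_self (B : Subalgebra K A) [IsNoetherianRing B] [Module.Finite B A]
    [FiniteDimensional K (selfRes B).coker.V]
    (hA : ∀ (V₀ : Type u) [AddCommGroup V₀] [Module K V₀] [FiniteDimensional K V₀]
      (S : Submodule A (tens (A ⊗[K] V₀) (RMod.self K A)).V) (hS), ((tens _ _).sub S hS).FG)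
    (n : ℕ) :
    FinRel (E := fun n => ((Bim.self K A).pow n).V) (Bim.self K A).D ⊤
      (fun n => LinearMap.range (Bim.iota B n (Bim.self K A) ∘ₗ ((selfRes B).map n).lin)) n := by
  set M := Bim.self K A with hMdef
  have hM : M.FG := by
    refine ⟨{(1 : A)}, fun S _ h1 => ?_⟩
    have h1' : (1 : A) ∈ S := h1 (by simp)
    refine top_le_iff.1 fun (x : A) _ => ?_
    have := S.smul_mem x h1'
    exact (mul_one x) ▸ this
  have h1 : FinRel (E := fun n => (M.pow n).V) M.D ⊤
      (fun n => LinearMap.range (Bim.iota B n M)) n := hM.finPair B hA n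
  have h2 : (selfRes B).coker.FinH n :=
    Bim.finH_of_rightCofinite n _ (.of_restrictScalars_finite K B _) (Bim.rightCofinite_of_finiteDimensional _)
  have h3 := (selfRes B).finRel_range _ (selfRes B).exact_cokerHom (selfRes B).cokerHom_surjective h2
  have h4 := (finRel_map_iff (d' := M.D) (fun n => Bim.iota B n M) (fun n x => Bim.d_iota B n M x)
    (fun n => (LinearMap.ker_eq_bot.2 (Bim.iota_injective B n M)).le.trans bot_le) n).2 h3
  refine h1.trans (fun n => Bim.d_d n M) ?_ le_top ?_
  · rintro n _ ⟨x, rfl⟩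
    exact ⟨_, rfl⟩
  · have e1 : (fun n => (⊤ : Submodule K ((M.res B).pow n).V).map (Bim.iota B n M)) =
        fun n => LinearMap.range (Bim.iota B n M) := by
      funext n
      exact Submodule.map_top _
    have e2 : (fun n => (LinearMap.range ((selfRes B).map n).lin).map (Bim.iota B n M)) =
        fun n => LinearMap.range (Bim.iota B n M ∘ₗ ((selfRes B).map n).lin) := by
      funext n
      exact (LinearMap.range_comp _ _).symm
    exact (congrArg₂ (fun Y X => FinRel (E := fun n => (M.pow n).V) M.D Y X n) e1 e2).mp h4

end Pairs

/-! ### The recursive complex agrees with the complex of tensor powers. -/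

section Comparison

variable {K : Type v} [Field K] {A : Type u} [Ring A] [Algebra K A]

/-- The pure tensor `m ⊗ a₁ ⊗ ⋯ ⊗ aₙ` in `C_n(A, M)`. -/
def Bim.pure : ∀ (n : ℕ) (M : Bim K A), M.V →ₗ[K] MultilinearMap K (fun _ : Fin n => A) (M.pow n).V
  | 0, M => (MultilinearMap.constLinearEquivOfIsEmpty K K (fun _ : Fin 0 => A) M.V).toLinearMap
  | n + 1, M => (multilinearCurryLeftEquiv K (fun _ : Fin (n + 1) => A) _).symm.toLinearMap ∘ₗ
      TensorProduct.curry (Bim.pure n M.P)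

theorem Bim.pure_succ (n : ℕ) (M : Bim K A) (m : M.V) (a : Fin (n + 1) → A) :
    M.pure (n + 1) m a = M.P.pure n (m ⊗ₜ[K] a 0) (Fin.tail a) := rfl

theorem Bim.pow_ext {X : Type*} [AddCommGroup X] [Module K X] (n : ℕ) {M : Bim K A}
    {f g : (M.pow n).V →ₗ[K] X} (h : ∀ m a, f (M.pure n m a) = g (M.pure n m a)) : f = g := by
  induction n generalizing M with
  | zero => exact LinearMap.ext fun m => h m Fin.elim0
  | succ n ih =>
    refine ih (M := M.P) fun m a => ?_
    induction m using tens_induction with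
    | zero => simp
    | add x y hx hy => simp only [map_add, add_apply, hx, hy]
    | tmul m b => exact h m (Fin.cons b a)

/-- The universal property of `C_n(A, M)`. -/
def Bim.powLift {X : Type*} [AddCommGroup X] [Module K X] : ∀ (n : ℕ) (M : Bim K A)
    (_ : M.V →ₗ[K] MultilinearMap K (fun _ : Fin n => A) X), (M.pow n).V →ₗ[K] X
  | 0, _, φ =>
    (MultilinearMap.constLinearEquivOfIsEmpty K K (fun _ : Fin 0 => A) X).symm.toLinearMap ∘ₗ φ
  | n + 1, M, φ => Bim.powLift n M.P (TensorProduct.lift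
      ((multilinearCurryLeftEquiv K (fun _ : Fin (n + 1) => A) X).toLinearMap ∘ₗ φ))

theorem Bim.powLift_pure {X : Type*} [AddCommGroup X] [Module K X] (n : ℕ) (M : Bim K A)
    (φ : M.V →ₗ[K] MultilinearMap K (fun _ : Fin n => A) X) (m : M.V) (a : Fin n → A) :
    M.powLift n φ (M.pure n m a) = φ m a := by
  induction n generalizing M with
  | zero => exact congrArg (φ m) (Subsingleton.elim _ _)
  | succ n ih =>
    rw [pure_succ]
    refine (ih M.P _ _ _).trans ?_
    change φ m (Fin.cons (a 0) (Fin.tail a)) = _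
    rw [Fin.cons_self_tail]

theorem BHom.map_pure (n : ℕ) {M N : Bim K A} (g : BHom M N) (m : M.V) (a : Fin n → A) :
    (g.map n).f (M.pure n m a) = N.pure n (g.f m) a := by
  induction n generalizing M N with
  | zero => rfl
  | succ n ih => exact ih (pmap g.f) _ _

theorem Bim.iota_pure (B : Subalgebra K A) (n : ℕ) (M : Bim K A) (m : M.V) (b : Fin n → B) :
    Bim.iota B n M ((M.res B).pure n m b) = M.pure n m fun j => b j := by
  induction n generalizing M with
  | zero => rfl
  | succ n ih =>
    rw [iota_succ, pure_succ, pure_succ, BHom.map_pure]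
    exact ih M.P _ _

/-- The faces of `(m, a₁, …, aₙ₊₁)`: the bimodule component. -/
def Bim.faceL (M : Bim K A) {n : ℕ} (r : Fin (n + 2)) (m : M.V) (a : Fin (n + 1) → A) : M.V :=
  if (r : ℕ) = 0 then M.rho m (a 0) else if (r : ℕ) = n + 1 then a (Fin.last n) • m else m

/-- The faces of `(m, a₁, …, aₙ₊₁)`: the ring components. -/
def faceR {n : ℕ} (r : Fin (n + 2)) (a : Fin (n + 1) → A) : Fin n → A := fun j =>
  if (j : ℕ) + 1 < r then a j.castSucc
  else if (j : ℕ) + 1 = r then a j.castSucc * a j.succ else a j.succ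

theorem faceR_zero {n : ℕ} (a : Fin (n + 1) → A) : faceR 0 a = Fin.tail a := by
  funext j
  simp [faceR, Fin.tail]

/-- This is the combinatorial form of the recursion for the differential: grouping m ⊗ a₀ into one
entry lowers the index of each face of positive index by one. -/
theorem Bim.pure_face_succ (n : ℕ) (M : Bim K A) (r : Fin (n + 2)) (m : M.V)
    (a : Fin (n + 2) → A) :
    M.P.pure n (M.P.faceL r (m ⊗ₜ[K] a 0) (Fin.tail a)) (faceR r (Fin.tail a)) =
      M.pure (n + 1) (M.faceL r.succ m a) (faceR r.succ a) := by
  rw [pure_succ]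
  have h1 : faceR r (Fin.tail a) = Fin.tail (faceR r.succ a) := by
    funext j
    simp only [faceR, Fin.tail, Fin.val_succ]
    grind
  have h2 : M.P.faceL r (m ⊗ₜ[K] a 0) (Fin.tail a) =
      M.faceL r.succ m a ⊗ₜ[K] faceR r.succ a 0 := by
    simp only [faceL, faceR, Fin.tail, Fin.val_succ, Fin.val_zero]
    by_cases h : (r : ℕ) = 0
    · simp [h]
    · by_cases h' : (r : ℕ) = n + 1
      · simp [h', TensorProduct.smul_tmul']
      · simp [h, h', Nat.pos_of_ne_zero h]
  rw [h1, h2]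

theorem Bim.d_pure (n : ℕ) (M : Bim K A) (m : M.V) (a : Fin (n + 1) → A) :
    Bim.d n M (M.pure (n + 1) m a) =
      ∑ r : Fin (n + 2), (-1 : K) ^ (r : ℕ) • M.pure n (M.faceL r m a) (faceR r a) := by
  induction n generalizing M with
  | zero =>
    rw [Fin.sum_univ_two]
    change M.comm (m ⊗ₜ[K] a 0) = _
    rw [Bim.comm_tmul]
    simp [faceL, sub_eq_add_neg]
    rfl
  | succ n ih =>
    rw [d_succ, Fin.sum_univ_succ, pure_succ, ih, sub_eq_add_neg, ← Finset.sum_neg_distrib]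
    congr 1
    · rw [BHom.map_pure]
      rw [faceR_zero]
      simp [faceL]
      rfl
    · refine Finset.sum_congr rfl fun r _ => ?_
      rw [pure_face_succ, Fin.val_succ, pow_succ, mul_neg_one, neg_smul]

theorem Bim.pure_face_self (n : ℕ) (r : Fin (n + 2)) (a : Fin (n + 2) → A) :
    (Bim.self K A).pure n ((Bim.self K A).faceL r (a 0) (Fin.tail a)) (faceR r (Fin.tail a)) =
      (Bim.self K A).pure n (face r a 0) (Fin.tail (face r a)) := by
  have h1 : faceR r (Fin.tail a) = Fin.tail (face r a) := by
    funext j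
    simp only [faceR, Fin.tail, face, Fin.val_succ]
    grind
  have h2 : (Bim.self K A).faceL r (a 0) (Fin.tail a) = face r a 0 := by
    simp only [faceL, face, Fin.tail, Fin.val_zero]
    by_cases h : (r : ℕ) = 0
    · simp [h]
    · by_cases h' : (r : ℕ) = n + 1
      · simp [h']
      · simp [h, h', Nat.pos_of_ne_zero h, Ne.symm h]
  rw [h1, h2]

/-- The Hochschild chains of an algebra, as chains with coefficients in the algebra. -/
def hochEquiv (K : Type v) [Field K] (A : Type u) [Ring A] [Algebra K A] (n : ℕ) :
    HochChain K A n ≃ₗ[K] ((Bim.self K A).pow n).V :=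
  LinearEquiv.ofLinearMap
    (PiTensorProduct.lift ((multilinearCurryLeftEquiv K (fun _ : Fin (n + 1) => A) _).symm
      ((Bim.self K A).pure n)))
    ((Bim.self K A).powLift n (multilinearCurryLeftEquiv K (fun _ : Fin (n + 1) => A) _
      (PiTensorProduct.tprod K)))
    (Bim.pow_ext n fun m a => by
      change PiTensorProduct.lift _ ((Bim.self K A).powLift n _ _) = _
      rw [Bim.powLift_pure]
      exact PiTensorProduct.lift.tprod (Fin.cons m a : Fin (n + 1) → A))
    (PiTensorProduct.ext (MultilinearMap.ext fun a => by
      change (Bim.self K A).powLift n _ (PiTensorProduct.lift _ (PiTensorProduct.tprod K a)) = _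
      rw [PiTensorProduct.lift.tprod]
      refine (Bim.powLift_pure n (Bim.self K A) _ (a 0) (Fin.tail a)).trans ?_
      change PiTensorProduct.tprod K (Fin.cons (a 0) (Fin.tail a)) = PiTensorProduct.tprod K a
      rw [Fin.cons_self_tail]))

theorem hochEquiv_tprod (n : ℕ) (a : Fin (n + 1) → A) :
    hochEquiv K A n (PiTensorProduct.tprod K a) = (Bim.self K A).pure n (a 0) (Fin.tail a) :=
  PiTensorProduct.lift.tprod a

theorem d_hochEquiv (n : ℕ) (x : HochChain K A (n + 1)) :
    (Bim.self K A).D n (hochEquiv K A (n + 1) x) = hochEquiv K A n (hochD K A n x) := by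
  have h : (Bim.self K A).D n ∘ₗ (hochEquiv K A (n + 1)).toLinearMap =
      (hochEquiv K A n).toLinearMap ∘ₗ hochD K A n := by
    refine PiTensorProduct.ext (MultilinearMap.ext fun a => ?_)
    change Bim.d n _ (hochEquiv K A (n + 1) (PiTensorProduct.tprod K a)) =
      hochEquiv K A n (hochD K A n (PiTensorProduct.tprod K a))
    rw [hochEquiv_tprod, hochD_tprod, Bim.d_pure, map_sum]
    refine Finset.sum_congr rfl fun r _ => ?_
    rw [map_smul, hochEquiv_tprod, Bim.pure_face_self]
  exact LinearMap.congr_fun h x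

theorem hochEquiv_hochMap (B : Subalgebra K A) (n : ℕ) (x : HochChain K B n) :
    hochEquiv K A n (hochMap K B.val n x) =
      Bim.iota B n (Bim.self K A) (((selfRes B).map n).f (hochEquiv K B n x)) := by
  have h : (hochEquiv K A n).toLinearMap ∘ₗ hochMap K B.val n =
      Bim.iota B n (Bim.self K A) ∘ₗ ((selfRes B).map n).lin ∘ₗ
        (hochEquiv K B n).toLinearMap := by
    refine PiTensorProduct.ext (MultilinearMap.ext fun a => ?_)
    change hochEquiv K A n (hochMap K B.val n (PiTensorProduct.tprod K a)) =
      Bim.iota B n (Bim.self K A) (((selfRes B).map n).f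
        (hochEquiv K B n (PiTensorProduct.tprod K a)))
    rw [hochMap_tprod, hochEquiv_tprod, hochEquiv_tprod, BHom.map_pure, Bim.iota_pure]
    rfl
  exact LinearMap.congr_fun h x

theorem finiteDimensional_relHH_of_finRel (B : Subalgebra K A) (n : ℕ)
    (h : FinRel (E := fun n => ((Bim.self K A).pow n).V) (Bim.self K A).D ⊤
      (fun n => LinearMap.range (Bim.iota B n (Bim.self K A) ∘ₗ ((selfRes B).map n).lin)) n) :
    FiniteDimensional K (RelHH B n) := by
  have h1 : FinRel (E := HochChain K A) (hochD K A) ⊤ (subChain B) n := by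
    refine (finRel_map_iff (d' := (Bim.self K A).D)
      (fun n => (hochEquiv K A n).toLinearMap) d_hochEquiv
      (fun n => (LinearEquiv.ker (hochEquiv K A n)).le.trans bot_le) n).1 ?_
    have e1 : (fun n => (⊤ : Submodule K (HochChain K A n)).map (hochEquiv K A n).toLinearMap) =
        ⊤ := by
      funext n
      rw [Submodule.map_top]
      exact LinearEquiv.range _
    have e2 : (fun n => (subChain B n).map (hochEquiv K A n).toLinearMap) = fun n =>
        LinearMap.range (Bim.iota B n (Bim.self K A) ∘ₗ ((selfRes B).map n).lin) := by
      funext n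
      ext y
      constructor
      · rintro ⟨_, ⟨x, rfl⟩, rfl⟩
        exact ⟨_, (hochEquiv_hochMap B n x).symm⟩
      · rintro ⟨x, rfl⟩
        obtain ⟨x, rfl⟩ := (hochEquiv K B n).surjective x
        exact ⟨_, ⟨x, rfl⟩, hochEquiv_hochMap B n x⟩
    exact (congrArg₂ (fun Y X => FinRel (E := fun n => ((Bim.self K A).pow n).V)
      (Bim.self K A).D Y X n) e1 e2).mpr h
  -- In the quotient complex the family `subChain B` becomes 0, so relative cycles and boundaries
  -- turn into ordinary ones.
  have h2 := (finRel_map_iff (d' := relD B) (fun n => (subChain B n).mkQ) (fun _ _ => rfl)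
    (fun n => (Submodule.ker_mkQ _).le) n).2 h1
  have e1 : pairCycles (relD B) (fun n => (⊤ : Submodule K (HochChain K A n)).map (subChain B n).mkQ)
      (fun n => (subChain B n).map (subChain B n).mkQ) n = relCycles B n := by
    cases n with
    | zero => exact (Submodule.map_top _).trans (Submodule.range_mkQ _)
    | succ n =>
      refine le_antisymm (fun x hx => ?_) fun x hx => ⟨?_, ?_⟩
      · obtain ⟨y, hy, e⟩ := hx.2
        have : (subChain B n).mkQ y = 0 := (Submodule.Quotient.mk_eq_zero _).2 hy
        exact e.symm.trans this
      · obtain ⟨y, rfl⟩ := Submodule.mkQ_surjective _ x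
        exact ⟨y, trivial, rfl⟩
      · exact ⟨0, zero_mem _, (map_zero _).trans (LinearMap.mem_ker.1 hx).symm⟩
  have e2 : pairBoundaries (relD B)
      (fun n => (⊤ : Submodule K (HochChain K A n)).map (subChain B n).mkQ)
      (fun n => (subChain B n).map (subChain B n).mkQ) n = relBoundaries B n := by
    rw [pairBoundaries, Submodule.map_top, Submodule.range_mkQ, Submodule.map_top,
      Submodule.mkQ_map_self, sup_bot_eq]
    rfl
  exact FinMod.finiteDimensional_quotient ((congrArg₂ FinMod e1 e2).mp h2)

end Comparison

/-! ### Noetherian consequences of generation over finitely many central elements. -/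

section Noetherian

/-- T generates a commutative finitely generated algebra, which is Noetherian by Hilbert's basis
theorem, and P is a submodule of the finitely generated module spanned by G. The formulation by
stable subspaces serves left ideals, subbimodules and Λ inside the matrices alike. -/
theorem exists_finset_generating {K V : Type*} [Field K] [AddCommGroup V] [Module K V]
    {T : Set (Module.End K V)} (hT : T.Finite) (hc : ∀ f ∈ T, ∀ g ∈ T, f * g = g * f)
    {G : Set V} (hG : G.Finite) (P : Submodule K V) (hPT : ∀ f ∈ T, ∀ x ∈ P, f x ∈ P)
    (hP : ∀ Q : Submodule K V, (∀ f ∈ T, ∀ x ∈ Q, f x ∈ Q) → G ⊆ Q → P ≤ Q) :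
    ∃ G' : Finset V, (G' : Set V) ⊆ P ∧
      ∀ Q : Submodule K V, (∀ f ∈ T, ∀ x ∈ Q, f x ∈ Q) → (G' : Set V) ⊆ Q → P ≤ Q := by
  let S : Subalgebra K (Module.End K V) := Algebra.adjoin K T
  have hcomm : IsMulCommutative S := Algebra.isMulCommutative_adjoin K hc
  let : CommRing S := { (inferInstance : Ring S) with mul_comm := hcomm.is_comm.comm }
  have hS : Algebra.FiniteType K S :=
    (Subalgebra.fg_iff_finiteType S).1 (Subalgebra.fg_def.2 ⟨T, hT, rfl⟩)
  have hN : IsNoetherianRing S := Algebra.FiniteType.isNoetherianRing K S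
  have key : ∀ Q : Submodule K V, (∀ f ∈ T, ∀ x ∈ Q, f x ∈ Q) →
      ∃ Q' : Submodule S V, (Q' : Set V) = Q := by
    intro Q hQ
    refine ⟨{ Q with smul_mem' := fun c x hx => ?_ }, rfl⟩
    obtain ⟨c, hc⟩ := c
    change c x ∈ Q
    induction hc using Algebra.adjoin_induction generalizing x with
    | mem f hf => exact hQ f hf x hx
    | algebraMap r => exact Q.smul_mem r hx
    | add f g _ _ hf hg => exact Q.add_mem (hf x hx) (hg x hx)
    | mul f g _ _ hf hg => exact hf _ (hg x hx)
  obtain ⟨P', hP'⟩ := key P hPT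
  have hle : P' ≤ Submodule.span S G := by
    intro x hx
    have h := hP ((Submodule.span S G).restrictScalars K)
      (fun f hf x hx => (Submodule.span S G).smul_mem ⟨f, Algebra.subset_adjoin hf⟩ hx)
      Submodule.subset_span
    exact h (hP' ▸ hx : x ∈ (P : Set V))
  obtain ⟨G', hG'⟩ := isNoetherian_submodule.1 (isNoetherian_span_of_finite S hG) P' hle
  refine ⟨G', ?_, fun Q hQ hGQ => ?_⟩
  · rw [← hP', ← hG']
    exact Submodule.subset_span
  · obtain ⟨Q', hQ'⟩ := key Q hQ
    have : P' ≤ Q' := by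
      rw [← hG', Submodule.span_le, hQ']
      exact hGQ
    intro x hx
    have hx' : x ∈ (P' : Set V) := hP' ▸ hx
    exact (hQ' ▸ this hx' : x ∈ (Q : Set V))

variable {K : Type v} [Field K] {A : Type u} [Ring A] [Algebra K A]

/-- `A` is generated by a finite set as a module over the subalgebra generated by `X`. -/
def GeneratedOver (K : Type v) [Field K] {A : Type u} [Ring A] [Algebra K A] (X G : Set A) : Prop :=
  ∀ Q : Submodule K A, (∀ x ∈ X, ∀ q ∈ Q, x * q ∈ Q) → G ⊆ Q → Q = ⊤

theorem isNoetherianRing_of_generatedOver {B : Subalgebra K A} {X G : Set A} (hX : X.Finite)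
    (hG : G.Finite) (hXG : GeneratedOver K X G) (hXB : X ⊆ B)
    (hc : ∀ x ∈ X, ∀ a, x * a = a * x) : IsNoetherianRing B := by
  rw [isNoetherianRing_iff_ideal_fg]
  intro I
  let P : Submodule K A := (I.restrictScalars K).map B.val.toLinearMap
  obtain ⟨G', hG', h⟩ := exists_finset_generating (K := K) (T := LinearMap.mulLeft K '' X)
    (hX.image _) (by
      rintro _ ⟨x, hx, rfl⟩ _ ⟨y, -, rfl⟩
      refine LinearMap.ext fun a => ?_
      change x * (y * a) = y * (x * a)
      rw [hc x hx, hc x hx a, mul_assoc]) hG P (by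
      rintro _ ⟨x, hx, rfl⟩ _ ⟨b, hb, rfl⟩
      exact ⟨⟨x, hXB hx⟩ * b, I.mul_mem_left _ hb, rfl⟩) (fun Q hQ hGQ => by
        rw [hXG Q (fun x hx => hQ _ ⟨x, hx, rfl⟩) hGQ]
        exact le_top)
  classical
  refine ⟨G'.preimage B.val Subtype.val_injective.injOn, le_antisymm ?_ ?_⟩
  · rw [Submodule.span_le]
    intro b hb
    obtain ⟨b', hb', e⟩ := hG' (Finset.mem_preimage.1 hb)
    exact Subtype.ext e ▸ hb'
  · intro b hb
    let J : Ideal B := Submodule.span B (G'.preimage B.val Subtype.val_injective.injOn)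
    have := h ((J.restrictScalars K).map B.val.toLinearMap) (by
      rintro _ ⟨x, hx, rfl⟩ _ ⟨b, hb, rfl⟩
      exact ⟨⟨x, hXB hx⟩ * b, J.mul_mem_left _ hb, rfl⟩) (fun g hg => by
        obtain ⟨b', hb', e⟩ := hG' hg
        exact ⟨b', Submodule.subset_span (Finset.mem_preimage.2 (by rw [← e] at hg; exact hg)), e⟩)
    obtain ⟨b', hb', e⟩ := this ⟨b, hb, rfl⟩
    exact Subtype.ext e ▸ hb'

theorem finite_of_generatedOver {B : Subalgebra K A} {X G : Set A}
    (hG : G.Finite) (hXG : GeneratedOver K X G) (hXB : X ⊆ B) : Module.Finite B A := by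
  refine ⟨Submodule.fg_def.2 ⟨G, hG, ?_⟩⟩
  have := hXG ((Submodule.span B G).restrictScalars K)
    (fun x hx q hq => (Submodule.span B G).smul_mem ⟨x, hXB hx⟩ hq) Submodule.subset_span
  exact (Submodule.restrictScalars_eq_top_iff K B A).1 this

/-- As XA ⊂ B, the subspace B + span(G) is stable under X and contains G, so it is all of A. -/
theorem finiteDimensional_coker_of_generatedOver {B : Subalgebra K A} {X G : Set A}
    (hG : G.Finite) (hXG : GeneratedOver K X G) (hXB : ∀ x ∈ X, ∀ a, x * a ∈ B) :
    FiniteDimensional K (selfRes B).coker.V := by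
  have h := hXG (Subalgebra.toSubmodule B ⊔ Submodule.span K G)
    (fun x hx q _ => Submodule.mem_sup_left (hXB x hx q))
    (Submodule.subset_span.trans (le_sup_right (a := Subalgebra.toSubmodule B)))
  refine ⟨Submodule.fg_def.2 ⟨(selfRes B).cokerHom.lin '' G, hG.image _, ?_⟩⟩
  rw [← Submodule.map_span]
  refine top_le_iff.1 fun y _ => ?_
  obtain ⟨a, rfl⟩ := (selfRes B).cokerHom_surjective y
  obtain ⟨b, hb, g, hg, rfl⟩ := Submodule.mem_sup.1
    (h ▸ Submodule.mem_top : (a : A) ∈ Subalgebra.toSubmodule B ⊔ Submodule.span K G)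
  refine ⟨g, hg, ?_⟩
  have hb' : (selfRes B).cokerHom.f b = 0 := ((selfRes B).exact_cokerHom b).2 ⟨⟨b, hb⟩, rfl⟩
  refine ((map_add (selfRes B).cokerHom.f b g).trans ?_).symm
  rw [hb', zero_add]
  rfl

/-- The left and the right multiplications by elements of X commute with each other, and under them
A ⊗ V₀ ⊗ A is generated by the finitely many g ⊗ v ⊗ g' with g, g' in G and v in a finite spanning
set of V₀. -/
theorem sub_fg_of_generatedOver {X G : Set A} (hX : X.Finite) (hG : G.Finite)
    (hXG : GeneratedOver K X G) (hc : ∀ x ∈ X, ∀ a, x * a = a * x) (V₀ : Type u) [AddCommGroup V₀]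
    [Module K V₀] [FiniteDimensional K V₀]
    (S : Submodule A (tens (A ⊗[K] V₀) (RMod.self K A)).V) (hS) :
    ((tens (A ⊗[K] V₀) (RMod.self K A)).sub S hS).FG := by
  set F := tens (A ⊗[K] V₀) (RMod.self K A) with hF
  let l : A → Module.End K F.V := fun x => Algebra.lsmul K K F.V x
  let r : A → Module.End K F.V := fun x => F.rho.flip x
  obtain ⟨t, ht⟩ := Module.Finite.fg_top (R := K) (M := V₀)
  let G₀ : Set F.V := (fun p : A × V₀ × A => ((p.1 ⊗ₜ[K] p.2.1) ⊗ₜ[K] p.2.2 : F.V)) ''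
    (G ×ˢ ((t : Set V₀) ×ˢ G))
  have hG₀ : G₀.Finite := (hG.prod (t.finite_toSet.prod hG)).image _
  have hgen : ∀ Q : Submodule K F.V, (∀ f ∈ l '' X ∪ r '' X, ∀ x ∈ Q, f x ∈ Q) → G₀ ⊆ Q →
      S.restrictScalars K ≤ Q := by
    intro Q hQ hGQ
    have hl : ∀ x ∈ X, ∀ a v b, (a ⊗ₜ[K] v) ⊗ₜ[K] b ∈ Q → ((x * a) ⊗ₜ[K] v) ⊗ₜ[K] b ∈ Q :=
      fun x hx a v b h => hQ (l x) (Or.inl ⟨x, hx, rfl⟩) _ h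
    have hr : ∀ x ∈ X, ∀ a v b, (a ⊗ₜ[K] v) ⊗ₜ[K] b ∈ Q → (a ⊗ₜ[K] v) ⊗ₜ[K] (x * b) ∈ Q := by
      intro x hx a v b h
      -- The right action of x on the bimodule produces bx, which equals xb because x is central.
      rw [hc x hx]
      exact hQ (r x) (Or.inr ⟨x, hx, rfl⟩) _ h
    have h1 : ∀ a, ∀ v ∈ t, ∀ b ∈ G, (a ⊗ₜ[K] v) ⊗ₜ[K] b ∈ Q := by
      intro a v hv b hb
      have := hXG (Q.comap ((TensorProduct.mk K (A ⊗[K] V₀) A).flip b ∘ₗ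
        (TensorProduct.mk K A V₀).flip v)) (fun x hx a ha => hl x hx a v b ha)
        (fun g hg => hGQ ⟨(g, v, b), ⟨hg, hv, hb⟩, rfl⟩)
      exact (this ▸ Submodule.mem_top : a ∈ Q.comap _)
    have h2 : ∀ a, ∀ v ∈ t, ∀ b, (a ⊗ₜ[K] v) ⊗ₜ[K] b ∈ Q := by
      intro a v hv b
      have := hXG (Q.comap (TensorProduct.mk K (A ⊗[K] V₀) A (a ⊗ₜ[K] v)))
        (fun x hx b hb => hr x hx a v b hb) (fun g hg => h1 a v hv g hg)
      exact (this ▸ Submodule.mem_top : b ∈ Q.comap _)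
    have h3 : ∀ a v b, (a ⊗ₜ[K] v) ⊗ₜ[K] b ∈ Q := by
      intro a v b
      have : Submodule.span K (t : Set V₀) ≤ Q.comap ((TensorProduct.mk K (A ⊗[K] V₀) A).flip b ∘ₗ
          TensorProduct.mk K A V₀ a) := Submodule.span_le.2 fun v hv => h2 a v hv b
      exact this (ht ▸ Submodule.mem_top)
    suffices h4 : ∀ m, m ∈ Q from fun m _ => h4 m
    intro m
    induction m using tens_induction with
    | zero => exact zero_mem _
    | add x y hx hy => exact add_mem hx hy
    | tmul w b =>
      induction w using TensorProduct.induction_on with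
      | zero =>
        rw [TensorProduct.zero_tmul]
        exact zero_mem _
      | add x y hx hy =>
        rw [TensorProduct.add_tmul]
        exact add_mem hx hy
      | tmul a v => exact h3 a v b
  obtain ⟨G', hG', h⟩ := exists_finset_generating (K := K) (T := l '' X ∪ r '' X)
    ((hX.image _).union (hX.image _)) (by
      have hlr : ∀ x y, l x * r y = r y * l x := fun x y =>
        LinearMap.ext fun m => (F.rho_smul x m y).symm
      have hll : ∀ x ∈ X, ∀ y, l x * l y = l y * l x := fun x hx y => by
        rw [← map_mul, hc x hx, map_mul]
      have hrr : ∀ x ∈ X, ∀ y, r x * r y = r y * r x := fun x hx y =>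
        LinearMap.ext fun m => by
          change F.rho (F.rho m y) x = F.rho (F.rho m x) y
          rw [← F.rho_mul, ← F.rho_mul, hc x hx]
      rintro _ (⟨x, hx, rfl⟩ | ⟨x, hx, rfl⟩) _ (⟨y, hy, rfl⟩ | ⟨y, hy, rfl⟩)
      · exact hll x hx y
      · exact hlr x y
      · exact (hlr y x).symm
      · exact hrr x hx y) hG₀ (S.restrictScalars K) (by
      rintro _ (⟨x, hx, rfl⟩ | ⟨x, hx, rfl⟩) m hm
      · exact S.smul_mem x hm
      · exact hS m hm x) hgen
  classical
  refine ⟨G'.preimage S.subtype Subtype.val_injective.injOn, fun Q hQ hGQ => ?_⟩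
  have := h ((Q.restrictScalars K).map (S.subtype.restrictScalars K)) (by
    rintro _ (⟨x, hx, rfl⟩ | ⟨x, hx, rfl⟩) _ ⟨m, hm, rfl⟩
    · exact ⟨x • m, Q.smul_mem x hm, rfl⟩
    · exact ⟨_, hQ m hm x, rfl⟩) (fun g hg =>
      ⟨⟨g, hG' hg⟩, hGQ (Finset.mem_coe.2 (Finset.mem_preimage.2 hg)), rfl⟩)
  refine top_le_iff.1 fun m _ => ?_
  obtain ⟨m', hm', e⟩ := this m.2
  exact Subtype.ext e ▸ hm'

theorem finiteDimensional_relHH {B : Subalgebra K A} {X G : Set A} (hX : X.Finite) (hG : G.Finite)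
    (hXG : GeneratedOver K X G) (hc : ∀ x ∈ X, ∀ a, x * a = a * x) (hXB : ∀ x ∈ X, ∀ a, x * a ∈ B)
    (n : ℕ) : FiniteDimensional K (RelHH B n) := by
  have hXB' : X ⊆ B := fun x hx => mul_one x ▸ hXB x hx 1
  have := isNoetherianRing_of_generatedOver hX hG hXG hXB' hc
  have := finite_of_generatedOver hG hXG hXB'
  have := finiteDimensional_coker_of_generatedOver hG hXG hXB
  exact finiteDimensional_relHH_of_finRel B n (finRel_self B
    (fun V₀ _ _ _ S hS => sub_fg_of_generatedOver hX hG hXG hc V₀ S hS) n)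

end Noetherian

/-! ### Gordan's lemma and degrees of lattice points of cones. -/

section Cones

variable {n : ℕ}

theorem exists_sum_of_mem_realCone {S : Finset (Fin n → ℤ)} {x : Fin n → ℝ}
    (hx : x ∈ realCone (S : Set (Fin n → ℤ))) :
    ∃ f : (Fin n → ℤ) → ℝ, (∀ g, 0 ≤ f g) ∧ x = ∑ g ∈ S, f g • toReal n g := by
  classical
  change x ∈ Submodule.span _ _ at hx
  induction hx using Submodule.span_induction with
  | zero => exact ⟨0, fun _ => le_rfl, by simp⟩
  | add x y _ _ hx hy =>
    obtain ⟨f, hf, rfl⟩ := hx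
    obtain ⟨g, hg, rfl⟩ := hy
    exact ⟨f + g, fun _ => add_nonneg (hf _) (hg _), by
      simp only [Pi.add_apply, add_smul, Finset.sum_add_distrib]⟩
  | smul c x _ hx =>
    obtain ⟨f, hf, rfl⟩ := hx
    exact ⟨fun g => c * f g, fun g => mul_nonneg c.2 (hf g), by
      rw [Finset.smul_sum]
      exact Finset.sum_congr rfl fun g _ => (mul_smul (c : ℝ) (f g) _).symm⟩
  | mem x hx =>
    obtain ⟨g, hg, rfl⟩ := hx
    refine ⟨Pi.single g 1, fun g' => ?_, ?_⟩
    · rw [Pi.single_apply]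
      split_ifs <;> simp
    · rw [Finset.sum_eq_single_of_mem g hg fun b _ hb => by simp [hb]]
      simp

/-- Gordan's lemma: up to a bounded part, a lattice point of the cone that is generated by `S`
is a sum of elements of `N • S`. -/
theorem exists_bounded_add_mem_closure (S : Finset (Fin n → ℤ)) (N : ℕ) (hN : 0 < N) :
    ∃ c : Fin n → ℤ, ∀ m, toReal n m ∈ realCone (S : Set (Fin n → ℤ)) →
      ∃ m₀ ∈ Set.Icc (-c) c, ∃ u ∈ AddSubmonoid.closure ((fun g => N • g) '' (S : Set (Fin n → ℤ))),
        m = m₀ + u := by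
  refine ⟨fun j => ∑ g ∈ S, N * |g j|, fun m hm => ?_⟩
  obtain ⟨f, hf, hm⟩ := exists_sum_of_mem_realCone hm
  have hN' : (0 : ℝ) < N := by exact_mod_cast hN
  -- Each coefficient is rounded down to a multiple of N. The remainders lie in [0, N), which gives
  -- the bound ∑ N|g_j| on the j-th coordinate of m - u.
  obtain ⟨u, hu⟩ : ∃ u, u = ∑ g ∈ S, ⌊f g / N⌋₊ • (N • g) := ⟨_, rfl⟩
  have hb : ∀ j, |(m - u) j| ≤ ∑ g ∈ S, N * |g j| := by
    intro j
    have e : ((m - u) j : ℝ) = ∑ g ∈ S, (f g - ⌊f g / N⌋₊ * N) * (g j : ℝ) := by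
      have := congrFun hm j
      simp only [toReal, AddMonoidHom.coe_mk, ZeroHom.coe_mk, Finset.sum_apply, Pi.smul_apply,
        smul_eq_mul] at this
      rw [Pi.sub_apply, Int.cast_sub, this, hu, Finset.sum_apply, Int.cast_sum,
        ← Finset.sum_sub_distrib]
      refine Finset.sum_congr rfl fun g _ => ?_
      rw [Pi.smul_apply, Pi.smul_apply, nsmul_eq_mul, nsmul_eq_mul]
      push_cast
      ring
    have : (|(m - u) j| : ℝ) ≤ ∑ g ∈ S, N * |(g j : ℝ)| := by
      rw [e]
      refine (Finset.abs_sum_le_sum_abs _ _).trans (Finset.sum_le_sum fun g _ => ?_)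
      rw [abs_mul]
      refine mul_le_mul_of_nonneg_right ?_ (abs_nonneg _)
      have h1 := Nat.floor_le (div_nonneg (hf g) hN'.le)
      have h2 := Nat.lt_floor_add_one (f g / N)
      rw [le_div_iff₀ hN'] at h1
      rw [div_lt_iff₀ hN'] at h2
      rw [abs_le]
      constructor <;> nlinarith
    exact_mod_cast this
  refine ⟨m - u, ⟨fun j => (abs_le.1 (hb j)).1, fun j => (abs_le.1 (hb j)).2⟩, u,
    hu ▸ sum_mem fun g hg => nsmul_mem (AddSubmonoid.subset_closure (Set.mem_image_of_mem _ hg)) _,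
    by abel⟩

/-- The degree extends to a linear form on ℝⁿ that is positive on the nonzero generators of the
cone, so a nonnegative combination of them is 0 or has positive value. Membership in the cone is
enough; m need not be given as an element of N. -/
theorem deg_pos_of_mem_realCone {N : AddSubmonoid (Fin n → ℤ)} {deg : (Fin n → ℤ) →+ ℤ}
    (hdeg : IsGradingOf deg N) {m : Fin n → ℤ}
    (hm : toReal n m ∈ realCone (N : Set (Fin n → ℤ))) (h0 : m ≠ 0) : 0 < deg m := by
  classical
  let φ : (Fin n → ℝ) →ₗ[ℝ] ℝ := ∑ j, (deg (Pi.single j 1) : ℝ) • LinearMap.proj j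
  have hφ : ∀ m, φ (toReal n m) = deg m := by
    intro m
    have e : m = ∑ j, m j • (Pi.single j 1 : Fin n → ℤ) := by
      ext i
      rw [Finset.sum_apply]
      simp [Pi.single_apply]
    conv_rhs => rw [e, map_sum]
    simp only [map_zsmul, smul_eq_mul]
    simp [φ, toReal, mul_comm]
  have key : ∀ x ∈ realCone (N : Set (Fin n → ℤ)), x = 0 ∨ 0 < φ x := by
    intro x hx
    change x ∈ Submodule.span _ _ at hx
    induction hx using Submodule.span_induction with
    | zero => exact Or.inl rfl
    | add x y _ _ hx hy =>
      rcases hx with rfl | hx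
      · simpa using hy
      · rcases hy with rfl | hy
        · simpa using Or.inr hx
        · exact Or.inr (by rw [map_add]; exact add_pos hx hy)
    | smul c x _ hx =>
      rcases hx with rfl | hx
      · exact Or.inl (smul_zero c)
      · rcases c.2.eq_or_lt with hc | hc
        · left
          change (c : ℝ) • x = 0
          rw [← hc, zero_smul]
        · right
          change 0 < φ ((c : ℝ) • x)
          rw [map_smul]
          exact mul_pos hc hx
    | mem x hx =>
      obtain ⟨g, hg, rfl⟩ := hx
      by_cases h : g = 0
      · exact Or.inl (by rw [h, map_zero])
      · right
        rw [hφ]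
        exact_mod_cast hdeg g hg h
  rcases key _ hm with h | h
  · refine absurd (funext fun j => ?_) h0
    have := congrFun h j
    simpa [toReal] using this
  · rw [hφ] at h
    exact_mod_cast h

end Cones

/-! ### The rings Λ(D, t) over their central monomials. -/

theorem scalar_mul_single {k : Type*} [Field k] {n : ℕ} (g m : Fin n → ℤ) (c : k) (p q : Fin 2) :
    Matrix.scalar (Fin 2) (monomial k g) * Matrix.single p q (AddMonoidAlgebra.single m c) =
      Matrix.single p q (AddMonoidAlgebra.single (g + m) c) := by
  rw [Matrix.scalar_apply, ← Matrix.smul_eq_diagonal_mul, Matrix.smul_single, smul_eq_mul,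
    monomial, AddMonoidAlgebra.single_mul_single, one_mul]

section Lambda

variable {k : Type*} [Field k] [CharZero k] {n : ℕ}

theorem mem_LamTrunc {D : PointedCone ℝ (Fin n → ℝ)} {t : Fin n → ℤ} {deg : (Fin n → ℤ) →+ ℤ}
    {s : ℕ} {x : LamRing k D t} : x ∈ LamTrunc k D t deg s ↔
      ∀ p q, ∀ m ∈ (lamVal k D t x p q).coeff.support, deg m = 0 ∨ (s : ℤ) ≤ deg m :=
  Iff.rfl

theorem support_lamVal {D : PointedCone ℝ (Fin n → ℝ)} {t : Fin n → ℤ} (x : LamRing k D t)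
    (p q : Fin 2) (m : Fin n → ℤ) (hm : m ∈ (lamVal k D t x p q).coeff.support) :
    m ∈ latticePoints D ∨ m - t ∈ latticePoints D := by
  classical
  obtain ⟨h00, ⟨h01, -⟩, ⟨f, hf, g, hg, e⟩, h11⟩ := x.2
  have h10 : ∀ m ∈ (lamVal k D t x 1 0).coeff.support,
      m ∈ latticePoints D ∨ m - t ∈ latticePoints D := by
    intro m hm
    have e' : lamVal k D t x 1 0 = f + monomial k t * g := e
    rw [e', AddMonoidAlgebra.coeff_add] at hm
    rcases Finset.mem_union.1 (Finsupp.support_add hm) with hm | hm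
    · exact Or.inl (hf m hm)
    · obtain ⟨a, ha, b, hb, rfl⟩ :=
        Finset.mem_add.1 (AddMonoidAlgebra.support_coeff_mul_subset _ _ hm)
      have ha' : a = t := Finset.mem_singleton.1 (Finsupp.support_single_subset ha)
      right
      rw [ha', add_sub_cancel_left]
      exact hg b hb
  fin_cases p <;> fin_cases q
  · exact Or.inl (h00 m hm)
  · exact Or.inl (h01 m hm)
  · exact h10 m hm
  · exact Or.inl (h11 m hm)

/-- The scalar matrix with a monomial in `k[L]` on the diagonal. -/
def scalarMonomial (D : PointedCone ℝ (Fin n → ℝ)) (t g : Fin n → ℤ) (hg : g ∈ latticePoints D) :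
    LamRing k D t :=
  ⟨Matrix.scalar (Fin 2) (monomial k g), by
    have h : monomial k g ∈ monoidRing k (latticePoints D) := by
      intro m hm
      have : m = g := Finset.mem_singleton.1 (Finsupp.support_single_subset hm)
      exact this ▸ hg
    refine ⟨by simpa using h, ⟨by simp, 0, zero_mem _, by simp⟩,
      ⟨0, zero_mem _, 0, zero_mem _, by simp⟩, by simpa using h⟩⟩

theorem scalarMonomial_mul_comm {D : PointedCone ℝ (Fin n → ℝ)} {t g : Fin n → ℤ}
    (hg : g ∈ latticePoints D) (x : LamRing k D t) :
    scalarMonomial D t g hg * x = x * scalarMonomial D t g hg :=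
  Subtype.ext (Matrix.scalar_commute _ (Commute.all _) x.1).eq

/-- By Gordan's lemma it suffices to take exponents in a box or in its translate by t, with
coefficients from a finite spanning set of k over ℚ. The matrices in G are taken in the ambient
matrix ring, as an elementary matrix of this kind need not lie in Λ. -/
theorem single_mem_of_stable [FiniteDimensional ℚ k] {S : Finset (Fin n → ℤ)} {N : ℕ} (hN : 0 < N)
    (t : Fin n → ℤ) : ∃ G : Set (Matrix (Fin 2) (Fin 2) (AddMonoidAlgebra k (Fin n → ℤ))),
      G.Finite ∧ ∀ Q : Submodule ℚ (Matrix (Fin 2) (Fin 2) (AddMonoidAlgebra k (Fin n → ℤ))),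
        (∀ g ∈ S, g ≠ 0 → ∀ x ∈ Q, Matrix.scalar (Fin 2) (monomial k (N • g)) * x ∈ Q) → G ⊆ Q →
        ∀ (p q : Fin 2) (m : Fin n → ℤ) (c : k),
          (m ∈ latticePoints (realCone (S : Set (Fin n → ℤ))) ∨
            m - t ∈ latticePoints (realCone (S : Set (Fin n → ℤ)))) →
          Matrix.single p q (AddMonoidAlgebra.single m c) ∈ Q := by
  obtain ⟨b, hb⟩ := exists_bounded_add_mem_closure S N hN
  obtain ⟨B, hB⟩ := Module.Finite.fg_top (R := ℚ) (M := k)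
  refine ⟨(fun x : (Fin 2 × Fin 2) × (Fin n → ℤ) × k =>
    Matrix.single x.1.1 x.1.2 (AddMonoidAlgebra.single x.2.1 x.2.2)) ''
      (Set.univ ×ˢ ((Set.Icc (-b) b ∪ (fun m => m + t) '' Set.Icc (-b) b) ×ˢ (B : Set k))),
    ?_, fun Q hQ hGQ p q m c hm => ?_⟩
  · exact (Set.finite_univ.prod (((Set.finite_Icc _ _).union
      ((Set.finite_Icc _ _).image _)).prod B.finite_toSet)).image _
  · have h1 : ∀ m ∈ Set.Icc (-b) b ∪ (fun m => m + t) '' Set.Icc (-b) b, ∀ c : k,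
        Matrix.single p q (AddMonoidAlgebra.single m c) ∈ Q := by
      intro m hm c
      let φ : k →ₗ[ℚ] Matrix (Fin 2) (Fin 2) (AddMonoidAlgebra k (Fin n → ℤ)) :=
        { toFun := fun c => Matrix.single p q (AddMonoidAlgebra.single m c)
          map_add' := fun c c' => by rw [AddMonoidAlgebra.single_add, Matrix.single_add]
          map_smul' := fun a c => by
            rw [RingHom.id_apply, Matrix.smul_single, AddMonoidAlgebra.smul_single] }
      have : Submodule.span ℚ (B : Set k) ≤ Q.comap φ := Submodule.span_le.2 fun c hc =>
        hGQ ⟨((p, q), m, c), ⟨trivial, hm, hc⟩, rfl⟩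
      exact this (hB ▸ Submodule.mem_top)
    have h2 : ∀ u ∈ AddSubmonoid.closure ((fun g => N • g) '' (S : Set (Fin n → ℤ))),
        ∀ m, Matrix.single p q (AddMonoidAlgebra.single m c) ∈ Q →
          Matrix.single p q (AddMonoidAlgebra.single (u + m) c) ∈ Q := by
      intro u hu
      induction hu using AddSubmonoid.closure_induction with
      | zero => simp
      | add x y _ _ hx hy =>
        intro m hm
        rw [add_assoc]
        exact hx _ (hy m hm)
      | mem x hx =>
        obtain ⟨g, hg, rfl⟩ := hx
        intro m hm
        by_cases h0 : g = 0
        · simpa [h0] using hm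
        · change Matrix.single p q (AddMonoidAlgebra.single (N • g + m) c) ∈ Q
          rw [← scalar_mul_single]
          exact hQ g hg h0 _ hm
    rcases hm with hm | hm
    · obtain ⟨m₀, hm₀, u, hu, rfl⟩ := hb m hm
      rw [add_comm]
      exact h2 u hu m₀ (h1 m₀ (Or.inl hm₀) c)
    · obtain ⟨m₀, hm₀, u, hu, e⟩ := hb (m - t) hm
      have e' : m = u + (m₀ + t) := by rw [eq_add_of_sub_eq e]; abel
      rw [e']
      exact h2 u hu _ (h1 _ (Or.inr ⟨m₀, hm₀, rfl⟩) c)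

/-- The scalar monomials (s+1)g, for nonzero g in S, satisfy the hypotheses of
`finiteDimensional_relHH` for Λ and Λ_[s]. -/
theorem finiteDimensional_lamHH [FiniteDimensional ℚ k] {S : Finset (Fin n → ℤ)}
    {D : PointedCone ℝ (Fin n → ℝ)} (hDS : D = realCone (S : Set (Fin n → ℤ))) (t : Fin n → ℤ)
    (deg : (Fin n → ℤ) →+ ℤ) (hdeg : ∀ m ∈ latticePoints D, m ≠ 0 → 0 < deg m) (ht : 0 ≤ deg t)
    (s i : ℕ) : FiniteDimensional ℚ (LamHH k D t deg s i) := by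
  classical
  have hSD : ∀ g ∈ S, (s + 1) • g ∈ latticePoints D := fun g hg => by
    refine nsmul_mem ?_ _
    change toReal n g ∈ D
    rw [hDS]
    exact Submodule.subset_span ⟨g, hg, rfl⟩
  -- The multiple s + 1 is positive even for s = 0, as Gordan's lemma requires, and it gives degree
  -- at least s + 1. The generator g = 0 is left out because it has degree 0.
  let X : Set (LamRing k D t) := {x | ∃ g, ∃ hg : g ∈ S, g ≠ 0 ∧
    x = scalarMonomial D t ((s + 1) • g) (hSD g hg)}
  have hX : X.Finite := by
    refine (Set.finite_range fun g : S => scalarMonomial (k := k) D t ((s + 1) • g.1)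
      (hSD g.1 g.2)).subset ?_
    rintro _ ⟨g, hg, -, rfl⟩
    exact ⟨⟨g, hg⟩, rfl⟩
  obtain ⟨G₀, hG₀, hgen⟩ := single_mem_of_stable (k := k) (S := S) (Nat.succ_pos s) t
  let ψ : LamRing k D t →ₗ[ℚ] Matrix (Fin 2) (Fin 2) (AddMonoidAlgebra k (Fin n → ℤ)) :=
    (lamVal k D t).toLinearMap
  have hψ : Function.Injective ψ := Subtype.val_injective
  let T : Set (Module.End ℚ (Matrix (Fin 2) (Fin 2) (AddMonoidAlgebra k (Fin n → ℤ)))) :=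
    (fun x => LinearMap.mulLeft ℚ (ψ x)) '' X
  -- The generators in G₀ may lie outside Λ. As Λ is a stable subspace of the module that they
  -- generate, Hilbert's basis theorem yields finitely many generators inside Λ.
  obtain ⟨G, hGP, hG⟩ := exists_finset_generating (K := ℚ) (T := T) (hX.image _) (by
      rintro _ ⟨x, hx, rfl⟩ _ ⟨y, -, rfl⟩
      obtain ⟨g, hg, -, rfl⟩ := hx
      refine LinearMap.ext fun a => ?_
      change ψ _ * (ψ y * a) = ψ y * (ψ _ * a)
      rw [← mul_assoc, ← mul_assoc]
      congr 1
      exact congrArg ψ (scalarMonomial_mul_comm (hSD g hg) y)) hG₀ (LinearMap.range ψ) (by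
      rintro _ ⟨x, hx, rfl⟩ _ ⟨y, rfl⟩
      exact ⟨x * y, rfl⟩) (by
      rintro Q hQ hGQ _ ⟨x, rfl⟩
      have h := hgen Q (fun g hg h0 y hy => hQ _ ⟨_, ⟨g, hg, h0, rfl⟩, rfl⟩ y hy) hGQ
      rw [Matrix.matrix_eq_sum_single (ψ x)]
      refine sum_mem fun p _ => sum_mem fun q _ => ?_
      have e := AddMonoidAlgebra.sum_coeff_single (ψ x p q)
      have hmem : (ψ x p q).coeff.sum AddMonoidAlgebra.single ∈
          Q.toAddSubmonoid.comap (Matrix.singleAddMonoidHom p q) :=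
        sum_mem fun m hm => h p q m _ (hDS ▸ support_lamVal x p q m hm)
      rw [e] at hmem
      exact hmem)
  refine finiteDimensional_relHH hX (G := ψ ⁻¹' G) (G.finite_toSet.preimage hψ.injOn) ?_ ?_ ?_ i
  · intro Q hQ hGQ
    have h := hG (Q.map ψ) (by
      rintro _ ⟨x, hx, rfl⟩ _ ⟨y, hy, rfl⟩
      exact ⟨x * y, hQ x hx y hy, rfl⟩) (fun g hg => by
      obtain ⟨y, rfl⟩ := hGP hg
      exact ⟨y, hGQ hg, rfl⟩)
    refine top_le_iff.1 fun y _ => ?_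
    obtain ⟨y', hy', e⟩ := h ⟨y, rfl⟩
    exact hψ e ▸ hy'
  · rintro _ ⟨g, hg, -, rfl⟩ a
    exact scalarMonomial_mul_comm _ a
  · rintro _ ⟨g, hg, h0, rfl⟩ a
    rw [mem_LamTrunc]
    intro p q m hm
    right
    have e : lamVal k D t (scalarMonomial D t ((s + 1) • g) (hSD g hg) * a) p q =
        monomial k ((s + 1) • g) * lamVal k D t a p q := by
      rw [map_mul]
      change (Matrix.scalar (Fin 2) (monomial k ((s + 1) • g)) * lamVal k D t a) p q = _
      rw [Matrix.scalar_apply, ← Matrix.smul_eq_diagonal_mul]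
      rfl
    rw [e] at hm
    obtain ⟨u, hu, w, hw, rfl⟩ :=
      Finset.mem_add.1 (AddMonoidAlgebra.support_coeff_mul_subset _ _ hm)
    have hu' : u = (s + 1) • g := Finset.mem_singleton.1 (Finsupp.support_single_subset hu)
    have hnonneg : ∀ m ∈ latticePoints D, 0 ≤ deg m := fun m hm => by
      by_cases h : m = 0
      · rw [h, map_zero]
      · exact (hdeg m hm h).le
    -- Exponents from the summand t k[L] of the lower left entry have degree at least deg t ≥ 0.
    have hw' : 0 ≤ deg w := by
      rcases support_lamVal a p q w hw with h | h
      · exact hnonneg w h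
      · have := hnonneg _ h
        rw [map_sub] at this
        omega
    have hgD : g ∈ latticePoints D := by
      change toReal n g ∈ D
      rw [hDS]
      exact Submodule.subset_span ⟨g, hg, rfl⟩
    have h1 := hdeg g hgD h0
    rw [hu', map_add, map_nsmul, nsmul_eq_mul]
    push_cast
    nlinarith

end Lambda

end PoleRing

end

/-! ### The main theorem. -/

open PoleRing in
theorem theorem6p1 {k : Type*} [Field k] [NumberField k] {n : ℕ}
    (M N : AddSubmonoid (Fin n → ℤ)) (hgp : gp N = ⊤)
    (h : Fin n → ℚ) (hh : IsCrossSectionForm h (realCone (N : Set (Fin n → ℤ))))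
    (hMN : IsPyramidalExtension h M N)
    (deg : (Fin n → ℤ) →+ ℤ) (hdeg : IsGradingOf deg N)
    (D D' : PointedCone ℝ (Fin n → ℝ)) (hD : IsRationalCone D) (hD' : IsRationalCone D')
    (hDD' : IsInnerCone D D') (hD'M : D' ≤ realCone (interiorMonoid M))
    (v : Fin n → ℚ) (hv : (fun j => (v j : ℝ)) ∈ Phi h N \ Phi h M)
    (t : Fin n → ℤ) (ht : t ≠ 0) (htv : ∃ a : ℝ, 0 ≤ a ∧ toReal n t = a • fun j => (v j : ℝ))
    (i s : ℕ) :
    FiniteDimensional ℚ (LinearMap.range (lamHHMap k hDD'.le t deg s i)) := by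
  obtain ⟨S, hS⟩ := hD.rational
  -- D ⊂ D' ⊂ ℝ₊M_* ⊂ ℝ₊N, so the nonzero lattice points of D have positive degree.
  have hDN : D ≤ realCone (N : Set (Fin n → ℤ)) := by
    refine (hDD'.le.trans hD'M).trans (Submodule.span_mono (Set.image_mono ?_))
    rintro m (hm | hm)
    · exact hMN.le hm.1
    · rw [Set.mem_singleton_iff.1 hm]
      exact N.zero_mem
  -- Being a nonnegative multiple of the point v of Φ(N), t lies in ℝ₊N; as t ≠ 0, its degree is
  -- positive.
  have htN : toReal n t ∈ realCone (N : Set (Fin n → ℤ)) := by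
    obtain ⟨a, ha, e⟩ := htv
    rw [e]
    exact Submodule.smul_mem (realCone (N : Set (Fin n → ℤ))) (⟨a, ha⟩ : {c : ℝ // 0 ≤ c}) hv.1.1
  have := finiteDimensional_lamHH (k := k) hS t deg
    (fun m hm h0 => deg_pos_of_mem_realCone hdeg (hDN hm) h0)
    (deg_pos_of_mem_realCone hdeg htN ht).le s i
  infer_instance
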